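/- Let $v:\mathbb R^2\to S^1$ be a Lipschitz map into the unit circle with least Lipschitz constant $\|v\|_{\mathrm{Lip}}$, and let $0<\delta<1$. A rectangle $R$ is a product $I\times J$ of two bounded nondegenerate intervals with respect to coordinate axes $(e,e^\perp)$, where $e$ is a unit vector and $e^\perp$ is $e$ rotated by $\pi/2$, and where $|I|\ge|J|>0$; write $L(R)=|I|$ and $W(R)=|J|$. Let $EX(R)\subset S^1$ be the arc centered at $e$ of length $W(R)/L(R)$, and put $V(R)=R\cap v^{-1}(EX(R))$. Define $$M_{v,\delta}f(x)=\sup_{R}\ \frac{\mathbf 1_R(x)}{|R|}\int_R|f(y)|\,dy ,$$ where the supremum is over all rectangles $R$ with $L(R)\le(100\|v\|_{\mathrm{Lip}})^{-1}$ (no restriction if $\|v\|_{\mathrm{Lip}}=0$) and $|V(R)|\ge\delta|R|$. Then $M_{v,\delta}$ is bounded from $L^2(\mathbb R^2)$ to $L^{2,\infty}(\mathbb R^2)$ with norm $\lesssim\delta^{-1/2}$. That is, there is an absolute constant $C$, independent of $v$ and $\delta$, such that for every $f\in L^2(\mathbb R^2)$ the function $M_{v,\delta}f$ is Lebesgue measurable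 and, for every $\lambda>0$, $$\bigl|\{x\in\mathbb R^2: M_{v,\delta}f(x)>\lambda\}\bigr|\le C\,\delta^{-1}\lambda^{-2}\|f\|_{L^2(\mathbb R^2)}^2 .$$ -/

import Mathlib

open MeasureTheory
open scoped ENNReal NNReal

noncomputable section

namespace LipKakeya

/-- The Euclidean plane. -/
abbrev Plane : Type := EuclideanSpace ℝ (Fin 2)

/-- The unit circle in the plane. -/
abbrev Circ : Type := Metric.sphere (0 : Plane) 1

/-- The vector `e` rotated by `π / 2` (counterclockwise). -/
def perp (e : Plane) : Plane := !₂[-e 1, e 0]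

/-- A nondegenerate closed rectangle `I × J` in the coordinate axes `(e, perp e)`, where
`I = [a₁, a₂]` and `J = [b₁, b₂]` satisfy `|I| ≥ |J| > 0`. -/
structure Rect where
  e : Circ
  a₁ : ℝ
  a₂ : ℝ
  b₁ : ℝ
  b₂ : ℝ
  width_pos : b₁ < b₂
  width_le_length : b₂ - b₁ ≤ a₂ - a₁

namespace Rect

/-- The length `|I|`. -/
def L (R : Rect) : ℝ := R.a₂ - R.a₁

/-- The width `|J|`. -/
def W (R : Rect) : ℝ := R.b₂ - R.b₁

/-- The set of points of the rectangle. -/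
def toSet (R : Rect) : Set Plane :=
  {x | inner ℝ (R.e : Plane) x ∈ Set.Icc R.a₁ R.a₂ ∧
    inner ℝ (perp (R.e : Plane)) x ∈ Set.Icc R.b₁ R.b₂}

/-- The interval of uncertainty: the closed arc of the unit circle centered at `e`, of arc
length `W / L`. (The unoriented angle between unit vectors is their arc distance.) -/
def EX (R : Rect) : Set Circ :=
  {u | InnerProductGeometry.angle (R.e : Plane) (u : Plane) ≤ (R.W / R.L) / 2}

/-- The part of the rectangle on which the vector field `v` points into the interval of
uncertainty. -/
def V (v : Plane → Circ) (R : Rect) : Set Plane := R.toSet ∩ v ⁻¹' R.EX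

end Rect

/-- The Lipschitz norm of a Lipschitz map: its least Lipschitz constant. -/
def lipNorm (v : Plane → Circ) : ℝ≥0 := sInf {K : ℝ≥0 | LipschitzWith K v}

/-- The rectangles over which the maximal function is formed: `L(R) ≤ (100 ‖v‖_Lip)⁻¹`
(no restriction if `‖v‖_Lip = 0`, as `0⁻¹ = ∞` in `ℝ≥0∞`) and `|V(R)| ≥ δ |R|`. -/
def Admissible (v : Plane → Circ) (δ : ℝ) (R : Rect) : Prop :=
  ENNReal.ofReal R.L ≤ (100 * (lipNorm v : ℝ≥0∞))⁻¹ ∧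
    ENNReal.ofReal δ * volume R.toSet ≤ volume (R.V v)

/-- The maximal function: the supremum over all admissible `R` of
`1_R(x) |R|⁻¹ ∫_R |f|`, with values in `[0, ∞]`. -/
def maximalFn (v : Plane → Circ) (δ : ℝ) (f : Plane → ℂ) (x : Plane) : ℝ≥0∞ :=
  ⨆ (R : Rect) (_ : Admissible v δ R),
    R.toSet.indicator (fun _ => (volume R.toSet)⁻¹ * ∫⁻ y in R.toSet, ‖f y‖ₑ) x

end LipKakeya

end

/-!
The maximal operator is linearized by duality: from finitely many admissible rectangles one selects
a subfamily `R_i` whose union has measure comparable to that of the whole family. By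
Cauchy–Schwarz the weak bound then follows from
`∑ i, ∑ j, |R_i ∩ R_j| ≲ δ⁻¹ ∑ i, |R_i|`.

For rectangles pointing near a fixed direction the selection is greedy, in order of decreasing
length: a rectangle is kept when it contains a point around which the enlarged kept rectangles have
small mean multiplicity on every vertical interval. The discarded rectangles lie in a set where a
one-dimensional maximal function is large, whose measure is controlled by the total area kept.

In the double sum, nearly parallel pairs are controlled through the free point of the shorter
rectangle. For the pairs transversal to a fixed `Q`, consider on the axis of `Q` the trace of the
set where the field follows `R`. The Lipschitz bound makes the traces of two rectangles disjoint
unless their angles with `Q` are comparable, and the density hypothesis gives each trace at least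
a proportion `δ` of the length of the crossing. A Vitali selection, together with the packing of
the crossings given by the free points, bounds the sum of `width / angle` by `δ⁻¹` times the length
of `Q`.
-/

namespace LipKakeya

section Packing

variable {ι : Type*} [LinearOrder ι] {s F : Finset ι} {x a ℓ : ι → ℝ}

/-- A finite family of masses `a i` placed at points `x i` of the line, with lengths `ℓ i ≥ a i`
that decrease along the order of `ι`, such that around each point `x i`, at each scale `r ≥ ℓ i`,
the earlier masses of length at least `r` have density at most one. -/
structure IsPackedMass (s : Finset ι) (x a ℓ : ι → ℝ) : Prop where
  length_pos : ∀ i ∈ s, 0 < ℓ i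
  le_length : ∀ i ∈ s, a i ≤ ℓ i
  length_antitoneOn : AntitoneOn ℓ s
  sum_le : ∀ i ∈ s, ∀ r, ℓ i ≤ r → ∀ G ⊆ s,
    (∀ j ∈ G, j < i ∧ |x j - x i| ≤ r ∧ r ≤ ℓ j) → ∑ j ∈ G, a j ≤ r

namespace IsPackedMass

theorem sum_le_two_mul (hs : IsPackedMass s x a ℓ) (hF : F ⊆ s) {c h : ℝ} {i₀ : ι} (hi₀ : i₀ ∈ s)
    (hlt₀ : ℓ i₀ < h) (hx₀ : ∀ i ∈ F, |x i - x i₀| ≤ h)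
    (hx : ∀ i ∈ F, x i ∈ Set.Icc c (c + h / 2)) (hℓ : ∀ i ∈ F, h / 2 ≤ ℓ i) :
    ∑ i ∈ F, a i ≤ 2 * h := by
  have hh : 0 < h := (hs.length_pos i₀ hi₀).trans hlt₀
  rcases F.eq_empty_or_nonempty with rfl | hne
  · simpa using hh.le
  set i := F.max' hne
  have hiF : i ∈ F := F.max'_mem hne
  have hanti : ∀ j ∈ F, ℓ i ≤ ℓ j := fun j hj =>
    hs.length_antitoneOn (hF hj) (hF hiF) (F.le_max' j hj)
  rcases lt_or_ge (ℓ i) h with hih | hih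
  · have hsum : ∑ j ∈ F.erase i, a j ≤ ℓ i := by
      refine hs.sum_le i (hF hiF) _ le_rfl _ ((F.erase_subset i).trans hF) fun j hj => ?_
      obtain ⟨hji, hjF⟩ := Finset.mem_erase.1 hj
      refine ⟨(F.le_max' j hjF).lt_of_ne hji, le_trans ?_ (hℓ i hiF), hanti j hjF⟩
      rw [abs_le]
      constructor <;> linarith [(hx j hjF).1, (hx j hjF).2, (hx i hiF).1, (hx i hiF).2]
    rw [← Finset.add_sum_erase F a hiF]
    linarith [hs.le_length i (hF hiF)]
  · have hsum : ∑ j ∈ F, a j ≤ h := by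
      refine hs.sum_le i₀ hi₀ _ hlt₀.le _ hF fun j hj => ?_
      have hhj : h ≤ ℓ j := hih.trans (hanti j hj)
      refine ⟨lt_of_not_ge fun hle => ?_, hx₀ j hj, hhj⟩
      linarith [hs.length_antitoneOn hi₀ (hF hj) hle]
    linarith

/-- Bisect the interval until its halves contain no point with length below their own. -/
theorem sum_le_four_mul_of_le_pow (hs : IsPackedMass s x a ℓ) {ε : ℝ} (hε : ∀ i ∈ s, ε ≤ ℓ i)
    (n : ℕ) (hF : F ⊆ s) {b h : ℝ} (hn : h ≤ 2 ^ n * ε) (hx : ∀ i ∈ F, x i ∈ Set.Icc b (b + h))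
    (hshort : ∃ i ∈ F, ℓ i < h) : ∑ i ∈ F, a i ≤ 4 * h := by
  induction n generalizing F b h with
  | zero =>
    obtain ⟨i, hi, hlt⟩ := hshort
    linarith [hε i (hF hi)]
  | succ n ih =>
    obtain ⟨i₀, hi₀, hlt₀⟩ := hshort
    have hhalf : ∀ G ⊆ F, ∀ c, (∀ i ∈ G, x i ∈ Set.Icc c (c + h / 2)) →
        ∑ i ∈ G, a i ≤ 2 * h := by
      intro G hG c hGx
      by_cases hlt : ∃ i ∈ G, ℓ i < h / 2
      · linarith [ih (hG.trans hF) (by rw [pow_succ] at hn; linarith) hGx hlt]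
      · push Not at hlt
        refine hs.sum_le_two_mul (hG.trans hF) (hF hi₀) hlt₀ (fun i hi => ?_) hGx hlt
        have hxi := hx i (hG hi)
        have hxi₀ := hx i₀ hi₀
        rw [abs_le]
        constructor <;> linarith [hxi.1, hxi.2, hxi₀.1, hxi₀.2]
    have hleft := hhalf (F.filter (x · ≤ b + h / 2)) (F.filter_subset _) b fun i hi =>
      ⟨(hx i (Finset.mem_filter.1 hi).1).1, (Finset.mem_filter.1 hi).2⟩
    have hright := hhalf (F.filter (¬x · ≤ b + h / 2)) (F.filter_subset _) (b + h / 2) fun i hi =>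
      ⟨(not_le.1 (Finset.mem_filter.1 hi).2).le, by
        linarith [(hx i (Finset.mem_filter.1 hi).1).2]⟩
    rw [← Finset.sum_filter_add_sum_filter_not F (x · ≤ b + h / 2)]
    linarith

theorem sum_le_four_mul (hs : IsPackedMass s x a ℓ) {b h : ℝ}
    (hx : ∀ i ∈ s, x i ∈ Set.Icc b (b + h)) (hshort : ∃ i ∈ s, ℓ i < h) :
    ∑ i ∈ s, a i ≤ 4 * h := by
  obtain ⟨i, hi, hmin⟩ := s.exists_min_image ℓ (hshort.imp fun _ => And.left)
  obtain ⟨n, hn⟩ := pow_unbounded_of_one_lt (h / ℓ i) (one_lt_two : (1 : ℝ) < 2)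
  exact hs.sum_le_four_mul_of_le_pow hmin n subset_rfl
    ((div_le_iff₀ (hs.length_pos i hi)).1 hn.le) hx hshort

end IsPackedMass

end Packing

section FiniteFamilies

theorem exists_greedy_selection {ι : Type*} [Finite ι] [LinearOrder ι]
    (P : ι → Finset ι → Prop) : ∃ S : Finset ι, ∀ i, i ∈ S ↔ P i (S.filter (· < i)) := by
  classical
  have := Fintype.ofFinite ι
  let sel : ι → Prop := WellFoundedLT.fix fun i sel =>
    P i (Finset.univ.filter fun j => ∃ h : j < i, sel j h)
  refine ⟨Finset.univ.filter sel, fun i => ?_⟩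
  have hsel : sel i = P i (Finset.univ.filter fun j => ∃ _ : j < i, sel j) :=
    WellFoundedLT.fix_eq _ i
  rw [Finset.mem_filter_univ, hsel]
  simp only [exists_prop, Finset.filter_filter, and_comm]

theorem exists_antitone_enumeration {α β : Type*} [LinearOrder β] (F : Finset α) (g : α → β) :
    ∃ R : Fin F.card → α, Antitone (g ∘ R) ∧ Set.range R = F := by
  let e : Fin F.card ≃ F := F.equivFin.symm
  let key : Fin F.card → βᵒᵈ := fun i => OrderDual.toDual (g (e i))
  refine ⟨fun i => e (Tuple.sort key i), fun i j hij => Tuple.monotone_sort key hij, ?_⟩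
  have hrange := ((Tuple.sort key).trans e).surjective.range_comp (Subtype.val : F → α)
  rwa [Subtype.range_coe] at hrange

theorem sum_sum_eq_diag_add_two_nsmul {ι M : Type*} [LinearOrder ι] [AddCommMonoid M]
    (s : Finset ι) (f : ι → ι → M) (hf : ∀ i j, f i j = f j i) :
    ∑ i ∈ s, ∑ j ∈ s, f i j = ∑ i ∈ s, f i i + 2 • ∑ i ∈ s, ∑ j ∈ s with j < i, f i j := by
  have hsplit : ∀ i ∈ s, ∑ j ∈ s, f i j =
      f i i + ∑ j ∈ s with j < i, f i j + ∑ j ∈ s with i < j, f i j := by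
    intro i hi
    rw [← Finset.sum_filter_add_sum_filter_not s (· < i), add_comm (f i i), add_assoc]
    congr 1
    rw [← Finset.sum_filter_add_sum_filter_not (s.filter (¬· < i)) (· = i), Finset.filter_filter,
      Finset.filter_filter]
    congr 1
    · rw [Finset.sum_eq_single_of_mem i (by simp [hi])]
      simp +contextual
    · refine Finset.sum_congr (Finset.filter_congr fun j _ => ?_) fun _ _ => rfl
      rw [not_lt, and_comm, ← ne_eq, ne_comm, lt_iff_le_and_ne, and_comm]
  have hswap : ∑ i ∈ s, ∑ j ∈ s with i < j, f i j = ∑ i ∈ s, ∑ j ∈ s with j < i, f i j := by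
    simp only [Finset.sum_filter]
    rw [Finset.sum_comm]
    simp only [hf]
  rw [Finset.sum_congr rfl hsplit, Finset.sum_add_distrib, Finset.sum_add_distrib, hswap, two_nsmul,
    add_assoc]

end FiniteFamilies

section Measure

theorem volume_le_of_forall_volume_closedBall_le (ν : Measure ℝ) [IsFiniteMeasure ν] {E : Set ℝ}
    (hE : ∀ y ∈ E, ∃ r > 0, volume (Metric.closedBall y r) ≤ ν (Metric.closedBall y r)) :
    volume E ≤ 5 * ν Set.univ := by
  choose! r hr₀ hr using hE
  have hr_le : ∀ y ∈ E, r y ≤ (ν Set.univ).toReal := by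
    intro y hy
    have h2r := (hr y hy).trans (measure_mono (Set.subset_univ _))
    rw [Real.volume_closedBall, ENNReal.ofReal_le_iff_le_toReal (measure_ne_top ν _)] at h2r
    linarith [hr₀ y hy]
  obtain ⟨u, huE, hdisj, hcov⟩ :=
    Vitali.exists_disjoint_subfamily_covering_enlargement_closedBall E id r _ hr_le 5 (by norm_num)
  have hcount : u.Countable := hdisj.countable_of_nonempty_interior fun y hy =>
    ⟨y, Metric.ball_subset_interior_closedBall (Metric.mem_ball_self (hr₀ y (huE hy)))⟩
  calc volume E ≤ volume (⋃ y ∈ u, Metric.closedBall y (5 * r y)) := by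
        refine measure_mono fun y hy => ?_
        obtain ⟨z, hz, hsub⟩ := hcov y hy
        exact Set.mem_biUnion hz (hsub (Metric.mem_closedBall_self (hr₀ y hy).le))
    _ ≤ ∑' y : u, volume (Metric.closedBall (y : ℝ) (5 * r y)) := measure_biUnion_le _ hcount _
    _ ≤ ∑' y : u, 5 * ν (Metric.closedBall (y : ℝ) (r y)) := by
        refine ENNReal.tsum_le_tsum fun y => ?_
        calc volume (Metric.closedBall (y : ℝ) (5 * r y))
            = 5 * volume (Metric.closedBall (y : ℝ) (r y)) := by
              rw [Real.volume_closedBall, Real.volume_closedBall, mul_left_comm,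
                ENNReal.ofReal_mul (by norm_num), ENNReal.ofReal_ofNat]
          _ ≤ _ := mul_le_mul_right (hr y (huE y.2)) 5
    _ = 5 * ν (⋃ y ∈ u, Metric.closedBall y (r y)) := by
        rw [ENNReal.tsum_mul_left]
        exact congrArg _ (measure_biUnion hcount hdisj fun _ _ =>
          Metric.isClosed_closedBall.measurableSet).symm
    _ ≤ 5 * ν Set.univ := by gcongr; exact Set.subset_univ _

/-- The points over `X` at vertical distance at most `w` from the graph of `φ`. -/
def graphNhd (X : Set ℝ) (φ : ℝ → ℝ) (w : ℝ) : Set (ℝ × ℝ) := {z | z.1 ∈ X ∧ |z.2 - φ z.1| ≤ w}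

theorem measurableSet_graphNhd {X : Set ℝ} (hX : MeasurableSet X) {φ : ℝ → ℝ} (hφ : Measurable φ)
    (w : ℝ) : MeasurableSet (graphNhd X φ w) :=
  have hdist : Measurable fun z : ℝ × ℝ => |z.2 - φ z.1| := by fun_prop
  (measurable_fst hX).inter (hdist measurableSet_Iic)

theorem volume_graphNhd {X : Set ℝ} (hX : MeasurableSet X) {φ : ℝ → ℝ} (hφ : Measurable φ)
    (w : ℝ) : volume (graphNhd X φ w) = volume X * ENNReal.ofReal (2 * w) := by
  have hslice : ∀ x, volume (Prod.mk x ⁻¹' graphNhd X φ w) =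
      X.indicator (fun _ => ENNReal.ofReal (2 * w)) x := by
    intro x
    by_cases hx : x ∈ X
    · have hball : Prod.mk x ⁻¹' graphNhd X φ w = Metric.closedBall (φ x) w := by
        ext y; simp [graphNhd, hx, Real.dist_eq]
      rw [hball, Real.volume_closedBall, Set.indicator_of_mem hx]
    · have hempty : Prod.mk x ⁻¹' graphNhd X φ w = ∅ := by ext y; simp [graphNhd, hx]
      rw [hempty, measure_empty, Set.indicator_of_notMem hx]
  rw [Measure.volume_eq_prod, Measure.prod_apply (measurableSet_graphNhd hX hφ w)]
  simp_rw [hslice]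
  rw [lintegral_indicator hX, setLIntegral_const, mul_comm]

theorem volume_graphNhd_closedBall {φ : ℝ → ℝ} (hφ : Measurable φ) (p w : ℝ) {r : ℝ} (hr : 0 ≤ r) :
    volume (graphNhd (Metric.closedBall p r) φ w) = ENNReal.ofReal (4 * r * w) := by
  rw [volume_graphNhd Metric.isClosed_closedBall.measurableSet hφ, Real.volume_closedBall,
    ← ENNReal.ofReal_mul (by positivity)]
  congr 1; ring

section Porous

variable {E : Type*} [NormedAddCommGroup E] [NormedSpace ℝ E]

theorem ball_add_smul_sub_subset_interior {C : Set E} (hC : Convex ℝ C) {x y : E} {ε t : ℝ}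
    (hx : x ∈ C) (hball : Metric.ball y ε ⊆ interior C) (ht : t ∈ Set.Ioc (0 : ℝ) 1) :
    Metric.ball (x + t • (y - x)) (t * ε) ⊆ interior C := by
  intro z hz
  have hz' : x + t⁻¹ • (z - x) ∈ Metric.ball y ε := by
    rw [Metric.mem_ball, dist_eq_norm] at hz ⊢
    have hscale : x + t⁻¹ • (z - x) - y = t⁻¹ • (z - (x + t • (y - x))) := by
      rw [smul_sub, smul_sub, smul_add, inv_smul_smul₀ ht.1.ne']
      abel
    rwa [hscale, norm_smul, norm_inv, Real.norm_of_nonneg ht.1.le, inv_mul_lt_iff₀ ht.1]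
  simpa [smul_inv_smul₀ ht.1.ne'] using hC.add_smul_sub_mem_interior hx (hball hz') ht

variable [FiniteDimensional ℝ E] [MeasurableSpace E] [BorelSpace E] (μ : Measure E)
  [μ.IsAddHaarMeasure]

theorem addHaar_inter_closedBall_div_le {s : Set E} {x y : E} {c r : ℝ} (hr : 0 < r) (hc : 0 < c)
    (hsub : Metric.ball y (c * r) ⊆ Metric.closedBall x r \ s) :
    μ (s ∩ Metric.closedBall x r) / μ (Metric.closedBall x r) ≤
      1 - ENNReal.ofReal (c ^ Module.finrank ℝ E) := by
  have hB₀ : μ (Metric.closedBall x r) ≠ 0 := (Metric.measure_closedBall_pos μ _ hr).ne'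
  have hBtop : μ (Metric.closedBall x r) ≠ ∞ := measure_closedBall_lt_top.ne
  have hball : μ (Metric.ball y (c * r)) / μ (Metric.closedBall x r) =
      ENNReal.ofReal (c ^ Module.finrank ℝ E) := by
    rw [Measure.addHaar_ball_of_pos μ _ (by positivity), mul_pow,
      ENNReal.ofReal_mul (by positivity), mul_assoc, ← Measure.addHaar_closedBall μ x hr.le,
      ENNReal.mul_div_cancel_right hB₀ hBtop]
  have hadd : μ (s ∩ Metric.closedBall x r) + μ (Metric.ball y (c * r)) ≤
      μ (Metric.closedBall x r) := by
    rw [← measure_union _ measurableSet_ball]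
    · exact measure_mono (Set.union_subset Set.inter_subset_right
        (hsub.trans Set.sdiff_subset))
    · exact Set.disjoint_left.2 fun z hz hzB => (hsub hzB).2 hz.1
  rw [← hball]
  refine ENNReal.le_sub_of_add_le_right (hball ▸ ENNReal.ofReal_ne_top) ?_
  rw [← ENNReal.add_div]
  exact ENNReal.div_le_of_le_mul (by rwa [one_mul])

/-- A porous set has density less than one at each of its points, so Lebesgue's density theorem
makes it null. -/
theorem addHaar_eq_zero_of_porous {s : Set E}
    (hs : ∀ x ∈ s, ∃ c > 0, ∃ r₀ > 0, ∀ r ∈ Set.Ioo 0 r₀,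
      ∃ y, Metric.ball y (c * r) ⊆ Metric.closedBall x r \ s) : μ s = 0 := by
  rw [← Measure.restrict_apply_self, measure_eq_zero_iff_ae_notMem]
  filter_upwards [Besicovitch.ae_tendsto_measure_inter_div μ s] with x htend hx
  obtain ⟨c, hc, r₀, hr₀, hporous⟩ := hs x hx
  have hle : (1 : ℝ≥0∞) ≤ 1 - ENNReal.ofReal (c ^ Module.finrank ℝ E) := by
    refine le_of_tendsto htend (Filter.eventually_of_mem (Ioo_mem_nhdsGT hr₀) fun r hr => ?_)
    obtain ⟨y, hy⟩ := hporous r hr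
    exact addHaar_inter_closedBall_div_le μ hr.1 hc hy
  refine absurd hle (not_le.2 (ENNReal.sub_lt_self ENNReal.one_ne_top one_ne_zero ?_))
  exact (ENNReal.ofReal_pos.2 (by positivity)).ne'

theorem addHaar_iUnion_diff_iUnion_interior {ι : Sort*} {C : ι → Set E}
    (hconv : ∀ i, Convex ℝ (C i)) (hint : ∀ i, (interior (C i)).Nonempty) :
    μ ((⋃ i, C i) \ ⋃ i, interior (C i)) = 0 := by
  refine addHaar_eq_zero_of_porous μ ?_
  rintro x ⟨hxC, -⟩
  obtain ⟨i, hi⟩ := Set.mem_iUnion.1 hxC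
  obtain ⟨y, hy⟩ := hint i
  obtain ⟨ε, hε, hball⟩ := Metric.isOpen_iff.1 isOpen_interior y hy
  have hD : 0 < dist y x + ε := by positivity
  refine ⟨ε / (dist y x + ε), by positivity, dist y x + ε, hD, fun r hr => ?_⟩
  set t := r / (dist y x + ε)
  have ht : t ∈ Set.Ioc (0 : ℝ) 1 := ⟨div_pos hr.1 hD, (div_le_one hD).2 hr.2.le⟩
  have htε : ε / (dist y x + ε) * r = t * ε := by ring
  have hcenter : dist (x + t • (y - x)) x = t * dist y x := by
    rw [dist_eq_norm, add_sub_cancel_left, norm_smul, Real.norm_of_nonneg ht.1.le, dist_eq_norm]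
  have hradius : t * ε + t * dist y x = r := by
    rw [← mul_add, add_comm ε, div_mul_cancel₀ _ hD.ne']
  refine ⟨x + t • (y - x), htε ▸ fun z hz => ⟨?_, fun hzs => hzs.2 ?_⟩⟩
  · refine (dist_triangle z (x + t • (y - x)) x).trans ?_
    rw [hcenter, ← hradius]
    gcongr
    exact hz.le
  · exact Set.mem_iUnion.2 ⟨i, ball_add_smul_sub_subset_interior (hconv i) hi hball ht hz⟩

end Porous

section Duality

variable {α ι : Type*} [MeasurableSpace α] (μ : Measure α) {S : Finset ι} {A : ι → Set α}

theorem lintegral_sq_sum_indicator (hA : ∀ i ∈ S, MeasurableSet (A i)) :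
    ∫⁻ x, (∑ i ∈ S, (A i).indicator (1 : α → ℝ≥0∞) x) ^ 2 ∂μ =
      ∑ i ∈ S, ∑ j ∈ S, μ (A i ∩ A j) := by
  have hmeas : ∀ i ∈ S, ∀ j ∈ S, Measurable ((A i ∩ A j).indicator (1 : α → ℝ≥0∞)) :=
    fun i hi j hj => measurable_one.indicator ((hA i hi).inter (hA j hj))
  have hmul : ∀ i j x, (A i).indicator (1 : α → ℝ≥0∞) x * (A j).indicator 1 x =
      (A i ∩ A j).indicator 1 x := fun i j x => by
    rw [Set.inter_indicator_one, Pi.mul_apply]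
  simp_rw [sq, Finset.sum_mul_sum, hmul]
  rw [lintegral_finsetSum _ fun i hi => Finset.measurable_fun_sum _ (hmeas i hi)]
  refine Finset.sum_congr rfl fun i hi => ?_
  rw [lintegral_finsetSum _ (hmeas i hi)]
  exact Finset.sum_congr rfl fun j hj => lintegral_indicator_one ((hA i hi).inter (hA j hj))

theorem sq_lintegral_mul_le {f g : α → ℝ≥0∞} (hf : AEMeasurable f μ) (hg : AEMeasurable g μ) :
    (∫⁻ x, f x * g x ∂μ) ^ 2 ≤ (∫⁻ x, f x ^ 2 ∂μ) * ∫⁻ x, g x ^ 2 ∂μ := by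
  have hholder := ENNReal.lintegral_mul_le_Lp_mul_Lq μ Real.HolderConjugate.two_two hf hg
  simp only [ENNReal.rpow_two] at hholder
  have hsq : ∀ a : ℝ≥0∞, (a ^ (1 / 2 : ℝ)) ^ 2 = a := fun a => by
    rw [← ENNReal.rpow_two, ← ENNReal.rpow_mul]
    norm_num
  refine (pow_le_pow_left' hholder 2).trans_eq ?_
  rw [mul_pow, hsq, hsq]

theorem sq_mul_sum_measure_le (hA : ∀ i ∈ S, MeasurableSet (A i)) (hAt : ∀ i ∈ S, μ (A i) ≠ ∞)
    {g : α → ℝ≥0∞} (hg : AEMeasurable g μ) {t B : ℝ≥0∞}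
    (havg : ∀ i ∈ S, t * μ (A i) ≤ ∫⁻ x in A i, g x ∂μ)
    (hmult : ∑ i ∈ S, ∑ j ∈ S, μ (A i ∩ A j) ≤ B * ∑ i ∈ S, μ (A i)) :
    t ^ 2 * ∑ i ∈ S, μ (A i) ≤ B * ∫⁻ x, g x ^ 2 ∂μ := by
  set X := ∑ i ∈ S, μ (A i)
  rcases eq_or_ne X 0 with hX₀ | hX₀
  · simp [hX₀]
  let N : α → ℝ≥0∞ := fun x => ∑ i ∈ S, (A i).indicator 1 x
  have hind : ∀ i ∈ S, Measurable ((A i).indicator (1 : α → ℝ≥0∞)) := fun i hi =>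
    measurable_one.indicator (hA i hi)
  have hdual : t * X ≤ ∫⁻ x, g x * N x ∂μ := by
    calc t * X = ∑ i ∈ S, t * μ (A i) := Finset.mul_sum _ _ _
      _ ≤ ∑ i ∈ S, ∫⁻ x in A i, g x ∂μ := Finset.sum_le_sum havg
      _ = ∑ i ∈ S, ∫⁻ x, g x * (A i).indicator 1 x ∂μ := by
          refine Finset.sum_congr rfl fun i hi => ?_
          rw [← lintegral_indicator (hA i hi)]
          simp only [← Set.indicator_mul_right, Pi.one_apply, mul_one]
      _ = ∫⁻ x, g x * N x ∂μ := by
          simp only [N, Finset.mul_sum]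
          exact (lintegral_finsetSum' _ fun i hi => hg.mul (hind i hi).aemeasurable).symm
  have hsq : t ^ 2 * X * X ≤ B * (∫⁻ x, g x ^ 2 ∂μ) * X := by
    calc t ^ 2 * X * X = (t * X) ^ 2 := by ring
      _ ≤ (∫⁻ x, g x * N x ∂μ) ^ 2 := by gcongr
      _ ≤ (∫⁻ x, g x ^ 2 ∂μ) * ∫⁻ x, N x ^ 2 ∂μ :=
          sq_lintegral_mul_le μ hg (Finset.measurable_fun_sum _ hind).aemeasurable
      _ ≤ (∫⁻ x, g x ^ 2 ∂μ) * (B * X) := by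
          gcongr
          exact (lintegral_sq_sum_indicator μ hA).trans_le hmult
      _ = _ := by ring
  exact (ENNReal.mul_le_mul_iff_left hX₀ (ENNReal.sum_ne_top.2 hAt)).1 hsq

end Duality

end Measure

/-- A parallelogram with two vertical sides: center `(p, q)`, half-length `ℓ`, vertical
half-width `w` and slope `m`. In suitable coordinates it contains a given rectangle and is
comparable to it. -/
structure Tube where
  p : ℝ
  q : ℝ
  ℓ : ℝ
  w : ℝ
  m : ℝ
  ℓ_pos : 0 < ℓ
  w_pos : 0 < w

namespace Tube

section Geometry

/-- The axis of the tube, as a function of the abscissa. -/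
def line (T : Tube) (x : ℝ) : ℝ := T.q + T.m * (x - T.p)

/-- The points of the tube. -/
def toSet (T : Tube) : Set (ℝ × ℝ) := graphNhd (Metric.closedBall T.p T.ℓ) T.line T.w

/-- The area of the tube. -/
def area (T : Tube) : ℝ := 4 * T.ℓ * T.w

/-- The tube dilated about its center by the factor `20`. -/
def enlarge (T : Tube) : Tube where
  p := T.p
  q := T.q
  ℓ := 20 * T.ℓ
  w := 20 * T.w
  m := T.m
  ℓ_pos := mul_pos (by norm_num) T.ℓ_pos
  w_pos := mul_pos (by norm_num) T.w_pos

theorem mem_toSet {T : Tube} {z : ℝ × ℝ} :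
    z ∈ T.toSet ↔ |z.1 - T.p| ≤ T.ℓ ∧ |z.2 - T.line z.1| ≤ T.w := by
  simp only [toSet, graphNhd, Metric.mem_closedBall, Real.dist_eq, Set.mem_ofPred_eq]

theorem measurable_line (T : Tube) : Measurable T.line := by
  unfold line; fun_prop

theorem measurableSet_toSet (T : Tube) : MeasurableSet T.toSet :=
  measurableSet_graphNhd Metric.isClosed_closedBall.measurableSet T.measurable_line T.w

theorem area_pos (T : Tube) : 0 < T.area := by
  have := T.ℓ_pos
  have := T.w_pos
  unfold area
  positivity

theorem volume_toSet (T : Tube) : volume T.toSet = ENNReal.ofReal T.area :=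
  volume_graphNhd_closedBall T.measurable_line T.p T.w T.ℓ_pos.le

theorem area_enlarge (T : Tube) : T.enlarge.area = 400 * T.area := by
  simp only [area, enlarge]; ring

theorem line_sub_line (R Q : Tube) (x x₀ : ℝ) :
    R.line x - Q.line x = (R.line x₀ - Q.line x₀) + (R.m - Q.m) * (x - x₀) := by
  unfold line; ring

/-- The abscissa at which the axes of two tubes of different slopes cross. -/
noncomputable def cross (R Q : Tube) : ℝ := Q.p - (R.line Q.p - Q.line Q.p) / (R.m - Q.m)

theorem line_sub_line_eq_mul_sub_cross {R Q : Tube} (h : R.m - Q.m ≠ 0) (x : ℝ) :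
    R.line x - Q.line x = (R.m - Q.m) * (x - R.cross Q) := by
  rw [line_sub_line R Q x Q.p]
  unfold cross
  field_simp
  ring

variable {R Q : Tube} {z z₀ : ℝ × ℝ}

theorem abs_line_sub_line_le_of_mem (hR : z ∈ R.toSet) (hQ : z ∈ Q.toSet) :
    |R.line z.1 - Q.line z.1| ≤ R.w + Q.w := by
  have hzR := abs_le.1 (mem_toSet.1 hR).2
  have hzQ := abs_le.1 (mem_toSet.1 hQ).2
  rw [abs_le]
  constructor <;> linarith

theorem abs_line_sub_le_of_meet (hz : z ∈ R.toSet) (hR : z₀ ∈ R.toSet) (hQ : z₀ ∈ Q.toSet) :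
    |Q.line z.1 - z.2| ≤ 2 * R.w + Q.w + 2 * (|R.m - Q.m| * R.ℓ) := by
  have hlines₀ := abs_line_sub_line_le_of_mem hR hQ
  have hlines := line_sub_line R Q z.1 z₀.1
  have hzx := abs_le.1 (mem_toSet.1 hz).1
  have hzx₀ := abs_le.1 (mem_toSet.1 hR).1
  have hzy := (mem_toSet.1 hz).2
  have hx : |z.1 - z₀.1| ≤ 2 * R.ℓ := by rw [abs_le]; constructor <;> linarith
  have hslope : |(R.m - Q.m) * (z.1 - z₀.1)| ≤ |R.m - Q.m| * (2 * R.ℓ) := by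
    rw [abs_mul]; gcongr
  rw [abs_le] at hlines₀ hslope hzy ⊢
  constructor <;> linarith

theorem abs_sub_center_le_of_meet (hz : z ∈ R.toSet) (hR : z₀ ∈ R.toSet) (hQ : z₀ ∈ Q.toSet)
    (hℓ : R.ℓ ≤ Q.ℓ) : |z.1 - Q.p| ≤ 3 * Q.ℓ := by
  have hz := abs_le.1 (mem_toSet.1 hz).1
  have hR := abs_le.1 (mem_toSet.1 hR).1
  have hQ := abs_le.1 (mem_toSet.1 hQ).1
  rw [abs_le]
  constructor <;> linarith

theorem volume_inter_le_length_mul_width (R Q : Tube) :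
    volume (R.toSet ∩ Q.toSet) ≤ ENNReal.ofReal (4 * R.ℓ * Q.w) := by
  rw [← volume_graphNhd_closedBall Q.measurable_line R.p Q.w R.ℓ_pos.le]
  exact measure_mono fun _ hz => ⟨hz.1.1, hz.2.2⟩

theorem volume_inter_le_of_slope_ne (h : R.m - Q.m ≠ 0) :
    volume (R.toSet ∩ Q.toSet) ≤ ENNReal.ofReal (8 * Q.w * (R.w / |R.m - Q.m|)) := by
  have hangle : 0 < |R.m - Q.m| := abs_pos.2 h
  have hRw := R.w_pos
  have hQw := Q.w_pos
  have hcross : ∀ z ∈ R.toSet ∩ Q.toSet,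
      z.1 ∈ Metric.closedBall (R.cross Q) ((R.w + Q.w) / |R.m - Q.m|) := by
    intro z hz
    rw [Metric.mem_closedBall, Real.dist_eq, le_div_iff₀ hangle, mul_comm, ← abs_mul,
      ← line_sub_line_eq_mul_sub_cross h]
    exact abs_line_sub_line_le_of_mem hz.1 hz.2
  have hbound : ∀ P : Tube, R.toSet ∩ Q.toSet ⊆ P.toSet → 2 * P.w ≤ 2 * min R.w Q.w →
      volume (R.toSet ∩ Q.toSet) ≤ ENNReal.ofReal (8 * Q.w * (R.w / |R.m - Q.m|)) := by
    intro P hP hPw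
    have hsubset : R.toSet ∩ Q.toSet ⊆
        graphNhd (Metric.closedBall (R.cross Q) ((R.w + Q.w) / |R.m - Q.m|)) P.line P.w :=
      fun z hz => ⟨hcross z hz, (hP hz).2⟩
    refine (measure_mono hsubset).trans ?_
    rw [volume_graphNhd_closedBall P.measurable_line _ P.w (by positivity)]
    refine ENNReal.ofReal_le_ofReal ?_
    have hPR : P.w ≤ R.w := by linarith [min_le_left R.w Q.w]
    have hPQ : P.w ≤ Q.w := by linarith [min_le_right R.w Q.w]
    rw [mul_div_assoc', mul_div_assoc', div_mul_eq_mul_div]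
    exact div_le_div_of_nonneg_right (by nlinarith) hangle.le
  rcases le_total R.w Q.w with hle | hle
  · exact hbound R Set.inter_subset_left (by rw [min_eq_left hle])
  · exact hbound Q Set.inter_subset_right (by rw [min_eq_right hle])

end Geometry

section Free

variable {ι : Type*} {T : ι → Tube} {S P : Finset ι}

/-- The point `z` is free of the tubes `T j`, `j ∈ S`, if on every vertical interval centered at
`z` the enlarged tubes have mean multiplicity at most `1 / 4`. -/
def Free (T : ι → Tube) (S : Finset ι) (z : ℝ × ℝ) : Prop :=
  ∀ r > 0, 4 * ∑ j ∈ S, volume (Metric.closedBall z.2 r ∩ Prod.mk z.1 ⁻¹' (T j).enlarge.toSet) ≤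
    volume (Metric.closedBall z.2 r)

theorem Free.mono {z : ℝ × ℝ} (hfree : Free T S z) (hP : P ⊆ S) : Free T P z := fun r hr =>
  (mul_le_mul_right (Finset.sum_le_sum_of_subset hP) 4).trans (hfree r hr)

theorem Free.sum_width_le {z : ℝ × ℝ} (hfree : Free T S z) {D : ℝ} (hD : 0 < D)
    (hx : ∀ j ∈ S, |z.1 - (T j).p| ≤ 20 * (T j).ℓ) (hy : ∀ j ∈ S, |(T j).line z.1 - z.2| ≤ D) :
    ∑ j ∈ S, 20 * (T j).w ≤ D / 2 := by
  have hmin : ∀ j, 0 ≤ 2 * min (20 * (T j).w) D := fun j =>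
    mul_nonneg zero_le_two (le_min (by linarith [(T j).w_pos]) hD.le)
  have hball : ∀ j ∈ S, Metric.closedBall ((T j).line z.1) (min (20 * (T j).w) D) ⊆
      Metric.closedBall z.2 (2 * D) ∩ Prod.mk z.1 ⁻¹' (T j).enlarge.toSet := by
    intro j hj y hyb
    rw [Metric.mem_closedBall, Real.dist_eq, le_min_iff] at hyb
    refine ⟨?_, mem_toSet.2 ⟨hx j hj, hyb.1⟩⟩
    have hyD := abs_le.1 hyb.2
    have hzD := abs_le.1 (hy j hj)
    rw [Metric.mem_closedBall, Real.dist_eq, abs_le]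
    constructor <;> linarith
  have hsum : 4 * ∑ j ∈ S, 2 * min (20 * (T j).w) D ≤ 2 * (2 * D) := by
    rw [← ENNReal.ofReal_le_ofReal_iff (by positivity), ENNReal.ofReal_mul (by norm_num),
      ENNReal.ofReal_ofNat, ENNReal.ofReal_sum_of_nonneg fun j _ => hmin j,
      ← Real.volume_closedBall z.2]
    refine le_trans ?_ (hfree (2 * D) (by positivity))
    gcongr with j hj
    rw [← Real.volume_closedBall ((T j).line z.1)]
    exact measure_mono (hball j hj)
  have hwidth : ∀ j ∈ S, min (20 * (T j).w) D = 20 * (T j).w := by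
    intro j hj
    have hj_le := Finset.single_le_sum (fun i _ => hmin i) hj
    refine min_eq_left (le_of_not_gt fun hlt => ?_)
    rw [min_eq_right hlt.le] at hj_le
    linarith
  rw [← Finset.mul_sum, Finset.sum_congr rfl hwidth] at hsum
  linarith

theorem volume_setOf_not_free_slice_le (T : ι → Tube) (S : Finset ι) (x : ℝ) :
    volume {y | ¬Free T S (x, y)} ≤
      20 * ∑ j ∈ S, volume (Prod.mk x ⁻¹' (T j).enlarge.toSet) := by
  have hfin : ∀ j, volume (Prod.mk x ⁻¹' (T j).enlarge.toSet) ≠ ∞ := fun j =>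
    measure_ne_top_of_subset
      (s := Metric.closedBall ((T j).enlarge.line x) (T j).enlarge.w)
      (fun _ hy => (mem_toSet.1 hy).2) measure_closedBall_lt_top.ne
  have : ∀ j, Fact (volume (Prod.mk x ⁻¹' (T j).enlarge.toSet) < ∞) := fun j =>
    ⟨(hfin j).lt_top⟩
  set ν : Measure ℝ :=
    (4 : ℝ≥0) • ∑ j ∈ S, volume.restrict (Prod.mk x ⁻¹' (T j).enlarge.toSet) with hν
  have hνball : ∀ B, MeasurableSet B →
      ν B = 4 * ∑ j ∈ S, volume (B ∩ Prod.mk x ⁻¹' (T j).enlarge.toSet) := by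
    intro B hB
    simp [hν, Measure.restrict_apply hB, ENNReal.smul_def]
  refine (volume_le_of_forall_volume_closedBall_le ν fun y hy => ?_).trans_eq ?_
  · simp only [Free, Set.mem_ofPred_eq, not_forall, not_le] at hy
    obtain ⟨r, hr, hlt⟩ := hy
    exact ⟨r, hr, (hνball _ Metric.isClosed_closedBall.measurableSet) ▸ hlt.le⟩
  · rw [hνball _ MeasurableSet.univ, ← mul_assoc]
    norm_num [Set.univ_inter]

theorem volume_le_of_forall_not_free {E : Set (ℝ × ℝ)} (hE : MeasurableSet E)
    (hfree : ∀ z ∈ E, ¬Free T S z) :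
    volume E ≤ ENNReal.ofReal (8000 * ∑ i ∈ S, (T i).area) := by
  have hslice : ∀ j, Measurable fun x => volume (Prod.mk x ⁻¹' (T j).enlarge.toSet) := fun j =>
    measurable_measure_prodMk_left (T j).enlarge.measurableSet_toSet
  have hvolume : ∀ j, ∫⁻ x, volume (Prod.mk x ⁻¹' (T j).enlarge.toSet) =
      ENNReal.ofReal (400 * (T j).area) := fun j => by
    rw [← Measure.prod_apply (T j).enlarge.measurableSet_toSet, ← Measure.volume_eq_prod,
      volume_toSet, area_enlarge]
  calc volume E = ∫⁻ x, volume (Prod.mk x ⁻¹' E) := by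
        rw [Measure.volume_eq_prod, Measure.prod_apply hE]
    _ ≤ ∫⁻ x, 20 * ∑ j ∈ S, volume (Prod.mk x ⁻¹' (T j).enlarge.toSet) :=
        lintegral_mono fun x => (measure_mono fun y hy => hfree (x, y) hy).trans
          (volume_setOf_not_free_slice_le T S x)
    _ = 20 * ∑ j ∈ S, ENNReal.ofReal (400 * (T j).area) := by
        rw [lintegral_const_mul _ (Finset.measurable_fun_sum _ fun j _ => hslice j),
          lintegral_finsetSum _ fun j _ => hslice j]
        simp_rw [hvolume]
    _ = ENNReal.ofReal (8000 * ∑ i ∈ S, (T i).area) := by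
        rw [← ENNReal.ofReal_sum_of_nonneg fun j _ => by linarith [(T j).area_pos],
          ← ENNReal.ofReal_ofNat 20, ← ENNReal.ofReal_mul (by norm_num), ← Finset.mul_sum]
        congr 1; ring

end Free

section Transversal

/-- The tubes meet, and the axis of `Q` stays within a bounded multiple of the width of `R` along
`R`. -/
structure Parallel (R Q : Tube) : Prop where
  meet : (R.toSet ∩ Q.toSet).Nonempty
  angle_le : |R.m - Q.m| * R.ℓ ≤ 10 * R.w

/-- The tube `R` meets the longer tube `Q`, whose axis it crosses at an angle that is large
compared with the eccentricity of `R` and with the width of `Q`. -/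
structure Transversal (R Q : Tube) : Prop where
  meet : (R.toSet ∩ Q.toSet).Nonempty
  length_le : R.ℓ ≤ Q.ℓ
  width_left_le : 10 * R.w ≤ |R.m - Q.m| * R.ℓ
  width_right_le : 10 * Q.w ≤ |R.m - Q.m| * R.ℓ

namespace Transversal

variable {R Q : Tube}

theorem angle_pos (h : Transversal R Q) : 0 < |R.m - Q.m| :=
  pos_of_mul_pos_left (by linarith [h.width_left_le, R.w_pos]) R.ℓ_pos.le

theorem slope_ne (h : Transversal R Q) : R.m - Q.m ≠ 0 := abs_pos.1 h.angle_pos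

theorem width_div_angle_nonneg (h : Transversal R Q) : 0 ≤ R.w / |R.m - Q.m| :=
  div_nonneg R.w_pos.le h.angle_pos.le

theorem width_div_angle_le (h : Transversal R Q) : R.w / |R.m - Q.m| ≤ R.ℓ := by
  rw [div_le_iff₀ h.angle_pos]
  linarith [h.width_left_le, R.w_pos]

theorem exists_abs_sub_cross_le (h : Transversal R Q) :
    ∃ x, |x - R.p| ≤ R.ℓ ∧ |x - Q.p| ≤ Q.ℓ ∧ |x - R.cross Q| ≤ R.ℓ / 5 := by
  obtain ⟨z, hR, hQ⟩ := h.meet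
  refine ⟨z.1, (mem_toSet.1 hR).1, (mem_toSet.1 hQ).1, le_of_mul_le_mul_left ?_ h.angle_pos⟩
  rw [← abs_mul, ← line_sub_line_eq_mul_sub_cross h.slope_ne]
  linarith [abs_line_sub_line_le_of_mem hR hQ, h.width_left_le, h.width_right_le]

theorem abs_cross_sub_left_le (h : Transversal R Q) : |R.cross Q - R.p| ≤ 6 / 5 * R.ℓ := by
  obtain ⟨x, hxR, -, hx⟩ := h.exists_abs_sub_cross_le
  rw [abs_le] at *
  constructor <;> linarith

theorem abs_cross_sub_right_le (h : Transversal R Q) : |R.cross Q - Q.p| ≤ 6 / 5 * Q.ℓ := by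
  obtain ⟨x, -, hxQ, hx⟩ := h.exists_abs_sub_cross_le
  have := h.length_le
  rw [abs_le] at *
  constructor <;> linarith

theorem abs_sub_cross_le (h : Transversal R Q) {x : ℝ} (hx : |x - R.p| ≤ R.ℓ) :
    |x - R.cross Q| ≤ 11 / 5 * R.ℓ := by
  have := h.abs_cross_sub_left_le
  rw [abs_le] at *
  constructor <;> linarith

theorem abs_line_sub_line_le (h : Transversal R Q) {x : ℝ} (hx : |x - R.p| ≤ R.ℓ) :
    |R.line x - Q.line x| ≤ |R.m - Q.m| * (11 / 5 * R.ℓ) := by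
  rw [line_sub_line_eq_mul_sub_cross h.slope_ne, abs_mul]
  exact mul_le_mul_of_nonneg_left (h.abs_sub_cross_le hx) h.angle_pos.le

theorem abs_sub_line_le (h : Transversal R Q) {z : ℝ × ℝ} (hz : z ∈ R.toSet) :
    |z.2 - Q.line z.1| ≤ 5 / 2 * (|R.m - Q.m| * R.ℓ) := by
  have hlines := abs_le.1 (h.abs_line_sub_line_le (mem_toSet.1 hz).1)
  have hzR := abs_le.1 (mem_toSet.1 hz).2
  have hpos := mul_pos h.angle_pos R.ℓ_pos
  rw [abs_le]
  constructor <;> linarith [h.width_left_le]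

end Transversal

end Transversal

section Field

variable {σ : ℝ × ℝ → ℝ} {K : ℝ≥0} {δ : ℝ} {R Q T : Tube}

/-- The points of the tube at which the slope field `σ` agrees with the slope of the tube up to
its eccentricity. -/
def V (σ : ℝ × ℝ → ℝ) (T : Tube) : Set (ℝ × ℝ) := {z ∈ T.toSet | |σ z - T.m| ≤ T.w / T.ℓ}

/-- The slope field `σ`, with vertical Lipschitz constant `K`, varies little over vertical
segments no longer than the tube and follows the tube on a proportion at least `δ` of it. -/
structure IsAdmissible (σ : ℝ × ℝ → ℝ) (K : ℝ≥0) (δ : ℝ) (T : Tube) : Prop where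
  lipschitz_mul_length_le : K * T.ℓ ≤ 1 / 25
  density_le : ENNReal.ofReal (δ * T.area) ≤ volume (V σ T)

/-- The abscissas in the range of `R` at which, on the axis of `Q`, the slope field `σ` is closer
to the slope of `R` than to that of `Q`. -/
def trace (σ : ℝ × ℝ → ℝ) (R Q : Tube) : Set ℝ :=
  {x | |x - R.p| ≤ R.ℓ ∧ |σ (x, Q.line x) - R.m| ≤ |R.m - Q.m| / 5}

theorem measurableSet_trace (hσ : Measurable σ) (R Q : Tube) : MeasurableSet (trace σ R Q) := by
  have hQ := Q.measurable_line
  have hx : Measurable fun x => |x - R.p| := by fun_prop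
  have hslope : Measurable fun x => |σ (x, Q.line x) - R.m| := by fun_prop
  exact (hx measurableSet_Iic).inter (hslope measurableSet_Iic)

namespace Transversal

/-- A vertical segment from a point of `R` to the axis of `Q` has length at most a multiple of
`|R.m - Q.m| * R.ℓ`, so along it the slope field changes by less than the angle. -/
theorem V_subset_graphNhd_trace (h : Transversal R Q) (hσ : ∀ x, LipschitzWith K fun y => σ (x, y))
    (hK : K * R.ℓ ≤ 1 / 25) : V σ R ⊆ graphNhd (trace σ R Q) R.line R.w := by
  rintro ⟨x, y⟩ ⟨hz, hslope⟩
  refine ⟨⟨(mem_toSet.1 hz).1, ?_⟩, (mem_toSet.1 hz).2⟩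
  have hecc : R.w / R.ℓ ≤ |R.m - Q.m| / 10 := by
    rw [div_le_div_iff₀ R.ℓ_pos (by norm_num)]
    linarith [h.width_left_le]
  have hvar : |σ (x, y) - σ (x, Q.line x)| ≤ |R.m - Q.m| / 10 := by
    calc |σ (x, y) - σ (x, Q.line x)| ≤ K * |y - Q.line x| := by
          simpa only [Real.dist_eq] using (hσ x).dist_le_mul y (Q.line x)
      _ ≤ K * (5 / 2 * (|R.m - Q.m| * R.ℓ)) := by gcongr; exact h.abs_sub_line_le hz
      _ = 5 / 2 * |R.m - Q.m| * (K * R.ℓ) := by ring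
      _ ≤ 5 / 2 * |R.m - Q.m| * (1 / 25) := by gcongr
      _ = |R.m - Q.m| / 10 := by ring
  have hR := hslope.trans hecc
  rw [abs_le] at hR hvar ⊢
  constructor <;> linarith

theorem volume_trace_ge (h : Transversal R Q) (hσm : Measurable σ)
    (hσ : ∀ x, LipschitzWith K fun y => σ (x, y)) (hR : IsAdmissible σ K δ R) :
    ENNReal.ofReal (2 * δ * R.ℓ) ≤ volume (trace σ R Q) := by
  have h2w : 0 < 2 * R.w := by linarith [R.w_pos]
  have hle := hR.density_le.trans
    (measure_mono (h.V_subset_graphNhd_trace hσ hR.lipschitz_mul_length_le))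
  have harea : δ * R.area = 2 * δ * R.ℓ * (2 * R.w) := by unfold area; ring
  rw [volume_graphNhd (measurableSet_trace hσm R Q) R.measurable_line, harea,
    ENNReal.ofReal_mul' h2w.le] at hle
  exact (ENNReal.mul_le_mul_iff_left (ENNReal.ofReal_pos.2 h2w).ne' ENNReal.ofReal_ne_top).1 hle

theorem trace_subset_closedBall (h : Transversal R Q) :
    trace σ R Q ⊆ Metric.closedBall Q.p (4 * Q.ℓ) := by
  intro x hx
  have hxR := abs_le.1 hx.1
  have hcross := abs_le.1 h.abs_cross_sub_left_le
  have hcross' := abs_le.1 h.abs_cross_sub_right_le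
  rw [Metric.mem_closedBall, Real.dist_eq, abs_le]
  constructor <;> linarith [h.length_le]

theorem abs_cross_sub_cross_le_of_trace_meet (hR : Transversal R Q) (hT : Transversal T Q)
    (hmeet : (trace σ R Q ∩ trace σ T Q).Nonempty) (hℓ : R.ℓ ≤ 2 * T.ℓ) :
    |R.cross Q - T.cross Q| ≤ 7 * T.ℓ := by
  obtain ⟨x, hxR, hxT⟩ := hmeet
  have hx := abs_le.1 (hR.abs_sub_cross_le hxR.1)
  have hx' := abs_le.1 (hT.abs_sub_cross_le hxT.1)
  rw [abs_le]
  constructor <;> linarith [T.ℓ_pos]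

end Transversal

theorem angle_le_of_trace_meet (hmeet : (trace σ R Q ∩ trace σ T Q).Nonempty) :
    |R.m - Q.m| ≤ 3 / 2 * |T.m - Q.m| := by
  obtain ⟨x, hxR, hxT⟩ := hmeet
  have htriangle := abs_sub_le R.m (σ (x, Q.line x)) T.m
  rw [abs_sub_comm R.m (σ _)] at htriangle
  linarith [hxR.2, hxT.2, abs_sub_le R.m T.m Q.m]

end Field

section Selection

variable {ι : Type*} {T : ι → Tube} {S : Finset ι}

theorem sum_length_le_of_pairwiseDisjoint_trace {G : Finset ι} {Q : Tube} {σ : ℝ × ℝ → ℝ}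
    {K : ℝ≥0} {δ : ℝ} (hσm : Measurable σ)
    (hσ : ∀ x, LipschitzWith K fun y => σ (x, y)) (hT : ∀ i ∈ G, IsAdmissible σ K δ (T i))
    (hδ : 0 < δ) (hGQ : ∀ i ∈ G, Transversal (T i) Q)
    (hdisj : (G : Set ι).PairwiseDisjoint fun i => trace σ (T i) Q) :
    ∑ i ∈ G, (T i).ℓ ≤ 4 * δ⁻¹ * Q.ℓ := by
  have hQ := Q.ℓ_pos
  have hvolume : ∑ i ∈ G, 2 * δ * (T i).ℓ ≤ 2 * (4 * Q.ℓ) := by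
    rw [← ENNReal.ofReal_le_ofReal_iff (by positivity), ← Real.volume_closedBall Q.p,
      ENNReal.ofReal_sum_of_nonneg fun i _ => mul_nonneg (by positivity) (T i).ℓ_pos.le]
    calc ∑ i ∈ G, ENNReal.ofReal (2 * δ * (T i).ℓ) ≤ ∑ i ∈ G, volume (trace σ (T i) Q) :=
          Finset.sum_le_sum fun i hi => (hGQ i hi).volume_trace_ge hσm hσ (hT i hi)
      _ = volume (⋃ i ∈ G, trace σ (T i) Q) :=
          (measure_biUnion_finset hdisj fun i _ => measurableSet_trace hσm (T i) Q).symm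
      _ ≤ volume (Metric.closedBall Q.p (4 * Q.ℓ)) :=
          measure_mono (Set.iUnion₂_subset fun i hi => (hGQ i hi).trace_subset_closedBall)
  rw [← Finset.mul_sum] at hvolume
  rw [mul_right_comm, ← div_eq_mul_inv, le_div_iff₀ hδ]
  linarith

theorem volume_iUnion_le_of_forall_not_free [Countable ι]
    (hS : ∀ i ∉ S, ∀ z ∈ (T i).toSet, ¬Free T S z) :
    volume (⋃ i, (T i).toSet) ≤ ENNReal.ofReal (8001 * ∑ i ∈ S, (T i).area) := by
  have hA : ∀ i ∈ S, 0 ≤ (T i).area := fun i _ => (T i).area_pos.le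
  have hselected : volume (⋃ i ∈ S, (T i).toSet) ≤ ENNReal.ofReal (∑ i ∈ S, (T i).area) := by
    refine (measure_biUnion_finset_le _ _).trans_eq ?_
    simp only [volume_toSet, ENNReal.ofReal_sum_of_nonneg hA]
  have hrejected : volume (⋃ i ∉ S, (T i).toSet) ≤
      ENNReal.ofReal (8000 * ∑ i ∈ S, (T i).area) := by
    refine volume_le_of_forall_not_free (.iUnion fun i => .iUnion fun _ =>
      (T i).measurableSet_toSet) fun z hz => ?_
    obtain ⟨i, hi, hzi⟩ := Set.mem_iUnion₂.1 hz
    exact hS i hi z hzi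
  calc volume (⋃ i, (T i).toSet)
      ≤ volume ((⋃ i ∈ S, (T i).toSet) ∪ ⋃ i ∉ S, (T i).toSet) := by
        refine measure_mono fun z hz => ?_
        obtain ⟨i, hi⟩ := Set.mem_iUnion.1 hz
        exact (em (i ∈ S)).imp (fun h => Set.mem_iUnion₂.2 ⟨i, h, hi⟩)
          fun h => Set.mem_iUnion₂.2 ⟨i, h, hi⟩
    _ ≤ ENNReal.ofReal (∑ i ∈ S, (T i).area) + ENNReal.ofReal (8000 * ∑ i ∈ S, (T i).area) :=
        (measure_union_le _ _).trans (add_le_add hselected hrejected)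
    _ = ENNReal.ofReal (8001 * ∑ i ∈ S, (T i).area) := by
        have := Finset.sum_nonneg hA
        rw [← ENNReal.ofReal_add this (by positivity)]
        congr 1; ring

variable [LinearOrder ι]

/-- A subfamily of tubes of decreasing lengths, each of which has a point free of the preceding
ones. -/
structure Selected (T : ι → Tube) (S : Finset ι) : Prop where
  length_antitoneOn : AntitoneOn (fun i => (T i).ℓ) S
  exists_free : ∀ i ∈ S, ∃ z ∈ (T i).toSet, Free T (S.filter (· < i)) z

namespace Selected

section Parallel

variable {i j : ι} {P : Finset ι}

theorem width_le (hS : Selected T S) (hi : i ∈ S) (hj : j ∈ S) (hji : j < i)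
    (hmeet : ((T i).toSet ∩ (T j).toSet).Nonempty) :
    39 * (T j).w ≤ 2 * (T i).w + 2 * (|(T i).m - (T j).m| * (T i).ℓ) := by
  obtain ⟨z, hz, hfree⟩ := hS.exists_free i hi
  obtain ⟨z₀, h₀i, h₀j⟩ := hmeet
  have hjS : {j} ⊆ S.filter (· < i) :=
    Finset.singleton_subset_iff.2 (Finset.mem_filter.2 ⟨hj, hji⟩)
  have hD : 0 < 2 * (T i).w + (T j).w + 2 * (|(T i).m - (T j).m| * (T i).ℓ) := by
    have := (T i).w_pos
    have := (T j).w_pos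
    have := (T i).ℓ_pos
    positivity
  have hx := abs_sub_center_le_of_meet hz h₀i h₀j (hS.length_antitoneOn hj hi hji.le)
  have hsum := (hfree.mono hjS).sum_width_le hD
    (by simpa using hx.trans (by linarith [(T j).ℓ_pos]))
    (by simpa using abs_line_sub_le_of_meet hz h₀i h₀j)
  rw [Finset.sum_singleton] at hsum
  linarith

theorem sum_width_parallel_le (hS : Selected T S) (hi : i ∈ S) (hP : P ⊆ S.filter (· < i))
    (hpar : ∀ j ∈ P, Parallel (T i) (T j)) : ∑ j ∈ P, (T j).w ≤ (T i).w := by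
  obtain ⟨z, hz, hfree⟩ := hS.exists_free i hi
  have hw := (T i).w_pos
  have hx : ∀ j ∈ P, |z.1 - (T j).p| ≤ 20 * (T j).ℓ := by
    intro j hj
    obtain ⟨hjS, hji⟩ := Finset.mem_filter.1 (hP hj)
    obtain ⟨z₀, h₀i, h₀j⟩ := (hpar j hj).meet
    have := abs_sub_center_le_of_meet hz h₀i h₀j (hS.length_antitoneOn hjS hi hji.le)
    linarith [(T j).ℓ_pos]
  have hy : ∀ j ∈ P, |(T j).line z.1 - z.2| ≤ 23 * (T i).w := by
    intro j hj
    obtain ⟨hjS, hji⟩ := Finset.mem_filter.1 (hP hj)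
    have hwidth := hS.width_le hi hjS hji (hpar j hj).meet
    obtain ⟨z₀, h₀i, h₀j⟩ := (hpar j hj).meet
    linarith [abs_line_sub_le_of_meet hz h₀i h₀j, (hpar j hj).angle_le]
  have hsum := (hfree.mono hP).sum_width_le (by positivity) hx hy
  rw [← Finset.mul_sum] at hsum
  linarith

theorem parallel_or_transversal (hS : Selected T S) (hi : i ∈ S) (hj : j ∈ S) (hji : j < i)
    (hmeet : ((T i).toSet ∩ (T j).toSet).Nonempty) :
    Parallel (T i) (T j) ∨ Transversal (T i) (T j) := by
  rcases le_total (|(T i).m - (T j).m| * (T i).ℓ) (10 * (T i).w) with hangle | hangle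
  · exact .inl ⟨hmeet, hangle⟩
  · refine .inr ⟨hmeet, hS.length_antitoneOn hj hi hji.le, hangle, ?_⟩
    linarith [hS.width_le hi hj hji hmeet, (T i).w_pos]

theorem sum_volume_inter_parallel_le (hS : Selected T S) (hi : i ∈ S)
    (hP : P ⊆ S.filter (· < i)) (hpar : ∀ j ∈ P, Parallel (T i) (T j)) :
    ∑ j ∈ P, volume ((T i).toSet ∩ (T j).toSet) ≤ ENNReal.ofReal (T i).area := by
  have hℓ : 0 ≤ 4 * (T i).ℓ := by linarith [(T i).ℓ_pos]
  calc ∑ j ∈ P, volume ((T i).toSet ∩ (T j).toSet)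
      ≤ ∑ j ∈ P, ENNReal.ofReal (4 * (T i).ℓ * (T j).w) :=
        Finset.sum_le_sum fun j _ => volume_inter_le_length_mul_width _ _
    _ = ENNReal.ofReal (4 * (T i).ℓ * ∑ j ∈ P, (T j).w) := by
        rw [Finset.mul_sum,
          ENNReal.ofReal_sum_of_nonneg fun j _ => mul_nonneg hℓ (T j).w_pos.le]
    _ ≤ ENNReal.ofReal (T i).area :=
        ENNReal.ofReal_le_ofReal
          (mul_le_mul_of_nonneg_left (hS.sum_width_parallel_le hi hP hpar) hℓ)

end Parallel

section Transversal

variable {Q : Tube} {G : Finset ι}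

theorem sum_width_div_angle_le (hS : Selected T S) {i : ι} (hi : i ∈ S)
    (hiQ : Transversal (T i) Q) {r : ℝ} (hr : (T i).ℓ ≤ r) (hG : G ⊆ S.filter (· < i))
    (hGQ : ∀ j ∈ G, Transversal (T j) Q)
    (hclose : ∀ j ∈ G, |(T j).cross Q - (T i).cross Q| ≤ r) (hlong : ∀ j ∈ G, r ≤ (T j).ℓ)
    (hcomp : ∀ j ∈ G, |(T j).m - Q.m| ≤ 9 / 4 * |(T i).m - Q.m|)
    (hcomp' : ∀ j ∈ G, |(T i).m - Q.m| ≤ 9 / 4 * |(T j).m - Q.m|) :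
    ∑ j ∈ G, (T j).w / |(T j).m - Q.m| ≤ r := by
  obtain ⟨z, hz, hfree⟩ := hS.exists_free i hi
  set θ := |(T i).m - Q.m|
  have hθ : 0 < θ := hiQ.angle_pos
  have hr₀ : 0 < r := (T i).ℓ_pos.trans_le hr
  have hθr : θ * (T i).ℓ ≤ θ * r := mul_le_mul_of_nonneg_left hr hθ.le
  have hcross : ∀ j ∈ G, |z.1 - (T j).cross Q| ≤ 16 / 5 * r := by
    intro j hj
    have hzi := abs_le.1 (hiQ.abs_sub_cross_le (mem_toSet.1 hz).1)
    have hj := abs_le.1 (hclose j hj)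
    rw [abs_le]
    constructor <;> linarith
  have hx : ∀ j ∈ G, |z.1 - (T j).p| ≤ 20 * (T j).ℓ := by
    intro j hj
    have hzj := abs_le.1 (hcross j hj)
    have hj' := abs_le.1 (hGQ j hj).abs_cross_sub_left_le
    have := hlong j hj
    rw [abs_le]
    constructor <;> linarith
  have hy : ∀ j ∈ G, |(T j).line z.1 - z.2| ≤ 10 * (θ * r) := by
    intro j hj
    have hline : |(T j).line z.1 - Q.line z.1| ≤ 9 / 4 * θ * (16 / 5 * r) := by
      rw [line_sub_line_eq_mul_sub_cross (hGQ j hj).slope_ne, abs_mul]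
      gcongr
      exacts [hcomp j hj, hcross j hj]
    have hj := abs_le.1 hline
    have hi := abs_le.1 (hiQ.abs_sub_line_le hz)
    rw [abs_le]
    constructor <;> linarith [mul_pos hθ hr₀]
  have hsum := (hfree.mono hG).sum_width_le (by positivity) hx hy
  rw [← Finset.mul_sum] at hsum
  calc ∑ j ∈ G, (T j).w / |(T j).m - Q.m| ≤ ∑ j ∈ G, 9 / 4 * (T j).w / θ := by
        refine Finset.sum_le_sum fun j hj => ?_
        rw [div_le_div_iff₀ (hGQ j hj).angle_pos hθ]
        nlinarith [hcomp' j hj, (T j).w_pos]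
    _ = 9 / 4 * (∑ j ∈ G, (T j).w) / θ := by rw [← Finset.sum_div, ← Finset.mul_sum]
    _ ≤ r := by
        rw [div_le_iff₀ hθ]
        linarith [mul_pos hθ hr₀]

theorem isPackedMass (hS : Selected T S) (hG : G ⊆ S) (hGQ : ∀ i ∈ G, Transversal (T i) Q)
    (hcomp : ∀ i ∈ G, ∀ j ∈ G, |(T i).m - Q.m| ≤ 9 / 4 * |(T j).m - Q.m|) :
    IsPackedMass G (fun i => (T i).cross Q) (fun i => (T i).w / |(T i).m - Q.m|)
      (fun i => (T i).ℓ) where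
  length_pos i _ := (T i).ℓ_pos
  le_length i hi := (hGQ i hi).width_div_angle_le
  length_antitoneOn := hS.length_antitoneOn.mono hG
  sum_le i hi _ hr _ hH h :=
    hS.sum_width_div_angle_le (hG hi) (hGQ i hi) hr
      (fun j hj => Finset.mem_filter.2 ⟨hG (hH hj), (h j hj).1⟩) (fun j hj => hGQ j (hH hj))
      (fun j hj => (h j hj).2.1) (fun j hj => (h j hj).2.2) (fun j hj => hcomp j (hH hj) i hi)
      (fun j hj => hcomp i hi j (hH hj))

variable {σ : ℝ × ℝ → ℝ} {K : ℝ≥0} {δ : ℝ}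

theorem sum_width_div_angle_le_of_trace_meet (hS : Selected T S) (hG : G ⊆ S)
    (hGQ : ∀ i ∈ G, Transversal (T i) Q) {k : ι} (hk : k ∈ G)
    (hmeet : ∀ i ∈ G, (trace σ (T i) Q ∩ trace σ (T k) Q).Nonempty)
    (hlong : ∀ i ∈ G, (T i).ℓ ≤ 2 * (T k).ℓ) :
    ∑ i ∈ G, (T i).w / |(T i).m - Q.m| ≤ 56 * (T k).ℓ := by
  have hcomp : ∀ i ∈ G, ∀ j ∈ G, |(T i).m - Q.m| ≤ 9 / 4 * |(T j).m - Q.m| := by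
    intro i hi j hj
    have hjk := angle_le_of_trace_meet (Set.inter_comm _ _ ▸ hmeet j hj)
    linarith [angle_le_of_trace_meet (hmeet i hi)]
  have hx : ∀ i ∈ G, (T i).cross Q ∈
      Set.Icc ((T k).cross Q - 7 * (T k).ℓ) ((T k).cross Q - 7 * (T k).ℓ + 14 * (T k).ℓ) := by
    intro i hi
    have := abs_le.1 ((hGQ i hi).abs_cross_sub_cross_le_of_trace_meet (hGQ k hk) (hmeet i hi)
      (hlong i hi))
    constructor <;> linarith
  have hsum := (hS.isPackedMass hG hGQ hcomp).sum_le_four_mul hx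
    ⟨k, hk, by linarith [(T k).ℓ_pos]⟩
  linarith

/-- A Vitali selection among the traces on the axis of `Q` leaves disjoint traces, whose total
length is controlled, and each discarded tube meets the trace of a selected one of comparable
length and angle. -/
theorem sum_width_div_angle_le_length (hS : Selected T S) (hσm : Measurable σ)
    (hσ : ∀ x, LipschitzWith K fun y => σ (x, y)) (hT : ∀ i, IsAdmissible σ K δ (T i))
    (hδ : 0 < δ) (hG : G ⊆ S) (hGQ : ∀ i ∈ G, Transversal (T i) Q) :
    ∑ i ∈ G, (T i).w / |(T i).m - Q.m| ≤ 224 * δ⁻¹ * Q.ℓ := by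
  classical
  have hne : ∀ i ∈ G, (trace σ (T i) Q).Nonempty := by
    intro i hi
    have hpos : 0 < 2 * δ * (T i).ℓ := mul_pos (by positivity) (T i).ℓ_pos
    exact nonempty_of_measure_ne_zero (μ := volume)
      ((ENNReal.ofReal_pos.2 hpos).trans_le ((hGQ i hi).volume_trace_ge hσm hσ (hT i))).ne'
  obtain ⟨u, huG, hdisj, hcover⟩ := Vitali.exists_disjoint_subfamily_covering_enlargement
    (fun i => trace σ (T i) Q) (G : Set ι) (fun i => (T i).ℓ) 2 (by norm_num)
    (fun i _ => (T i).ℓ_pos.le) Q.ℓ (fun i hi => (hGQ i hi).length_le) hne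
  choose! c hcu hmeet hlong using hcover
  let F := G.filter (· ∈ u)
  have hF : ∀ k ∈ F, k ∈ G ∧ k ∈ u := fun k hk => Finset.mem_filter.1 hk
  have hgroup : ∀ k ∈ F, ∑ i ∈ G with c i = k, (T i).w / |(T i).m - Q.m| ≤ 56 * (T k).ℓ := by
    intro k hk
    let H := G.filter fun i => (trace σ (T i) Q ∩ trace σ (T k) Q).Nonempty ∧
      (T i).ℓ ≤ 2 * (T k).ℓ
    have hH : ∀ i ∈ H, i ∈ G ∧ (trace σ (T i) Q ∩ trace σ (T k) Q).Nonempty ∧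
      (T i).ℓ ≤ 2 * (T k).ℓ := fun i hi => Finset.mem_filter.1 hi
    have hkH : k ∈ H := Finset.mem_filter.2 ⟨(hF k hk).1,
      (Set.inter_self _).symm ▸ hne k (hF k hk).1, by linarith [(T k).ℓ_pos]⟩
    have hfiber : (G.filter fun i => c i = k) ⊆ H := by
      intro i hi
      obtain ⟨hiG, rfl⟩ := Finset.mem_filter.1 hi
      exact Finset.mem_filter.2 ⟨hiG, hmeet i hiG, hlong i hiG⟩
    exact (Finset.sum_le_sum_of_subset_of_nonneg hfiber
      fun i hi _ => (hGQ i (hH i hi).1).width_div_angle_nonneg).trans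
      (hS.sum_width_div_angle_le_of_trace_meet (fun i hi => hG (hH i hi).1)
        (fun i hi => hGQ i (hH i hi).1) hkH (fun i hi => (hH i hi).2.1)
        fun i hi => (hH i hi).2.2)
  have hlength : ∑ k ∈ F, (T k).ℓ ≤ 4 * δ⁻¹ * Q.ℓ :=
    sum_length_le_of_pairwiseDisjoint_trace hσm hσ (fun k _ => hT k) hδ
      (fun k hk => hGQ k (hF k hk).1) (hdisj.subset fun k hk => (hF k hk).2)
  calc ∑ i ∈ G, (T i).w / |(T i).m - Q.m|
      = ∑ k ∈ F, ∑ i ∈ G with c i = k, (T i).w / |(T i).m - Q.m| :=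
        (Finset.sum_fiberwise_of_maps_to
          (fun i hi => Finset.mem_filter.2 ⟨huG (hcu i hi), hcu i hi⟩) _).symm
    _ ≤ ∑ k ∈ F, 56 * (T k).ℓ := Finset.sum_le_sum hgroup
    _ ≤ 224 * δ⁻¹ * Q.ℓ := by rw [← Finset.mul_sum]; linarith

theorem sum_volume_inter_transversal_le (hS : Selected T S) (hσm : Measurable σ)
    (hσ : ∀ x, LipschitzWith K fun y => σ (x, y)) (hT : ∀ i, IsAdmissible σ K δ (T i))
    (hδ : 0 < δ) (hG : G ⊆ S) (hGQ : ∀ i ∈ G, Transversal (T i) Q) :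
    ∑ i ∈ G, volume ((T i).toSet ∩ Q.toSet) ≤ ENNReal.ofReal (448 * δ⁻¹ * Q.area) := by
  have hw : 0 ≤ 8 * Q.w := by linarith [Q.w_pos]
  calc ∑ i ∈ G, volume ((T i).toSet ∩ Q.toSet)
      ≤ ∑ i ∈ G, ENNReal.ofReal (8 * Q.w * ((T i).w / |(T i).m - Q.m|)) :=
        Finset.sum_le_sum fun i hi => volume_inter_le_of_slope_ne (hGQ i hi).slope_ne
    _ = ENNReal.ofReal (8 * Q.w * ∑ i ∈ G, (T i).w / |(T i).m - Q.m|) := by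
        rw [Finset.mul_sum, ENNReal.ofReal_sum_of_nonneg fun i hi =>
          mul_nonneg hw (hGQ i hi).width_div_angle_nonneg]
    _ ≤ ENNReal.ofReal (8 * Q.w * (224 * δ⁻¹ * Q.ℓ)) :=
        ENNReal.ofReal_le_ofReal (mul_le_mul_of_nonneg_left
          (hS.sum_width_div_angle_le_length hσm hσ hT hδ hG hGQ) hw)
    _ = ENNReal.ofReal (448 * δ⁻¹ * Q.area) := by
        unfold area
        congr 1; ring

open scoped Classical in
theorem sum_sum_volume_inter_lt_le (hS : Selected T S) (hσm : Measurable σ)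
    (hσ : ∀ x, LipschitzWith K fun y => σ (x, y)) (hT : ∀ i, IsAdmissible σ K δ (T i))
    (hδ : 0 < δ) :
    ∑ i ∈ S, ∑ j ∈ S with j < i, volume ((T i).toSet ∩ (T j).toSet) ≤
      ENNReal.ofReal ((1 + 448 * δ⁻¹) * ∑ i ∈ S, (T i).area) := by
  have hA : ∀ i ∈ S, 0 ≤ (T i).area := fun i _ => (T i).area_pos.le
  have hsplit : ∀ i ∈ S, ∀ j ∈ S.filter (· < i), volume ((T i).toSet ∩ (T j).toSet) ≤
      (if Parallel (T i) (T j) then volume ((T i).toSet ∩ (T j).toSet) else 0) +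
      (if Transversal (T i) (T j) then volume ((T i).toSet ∩ (T j).toSet) else 0) := by
    intro i hi j hj
    obtain ⟨hjS, hji⟩ := Finset.mem_filter.1 hj
    rcases Set.eq_empty_or_nonempty ((T i).toSet ∩ (T j).toSet) with hempty | hmeet
    · simp only [hempty, measure_empty, zero_le]
    · rcases hS.parallel_or_transversal hi hjS hji hmeet with h | h
      · rw [if_pos h]; exact le_self_add
      · rw [if_pos h]; exact le_add_self
  have hpar : ∑ i ∈ S, ∑ j ∈ S with j < i,
      (if Parallel (T i) (T j) then volume ((T i).toSet ∩ (T j).toSet) else 0) ≤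
      ∑ i ∈ S, ENNReal.ofReal (T i).area := by
    refine Finset.sum_le_sum fun i hi => ?_
    rw [← Finset.sum_filter]
    exact hS.sum_volume_inter_parallel_le hi (Finset.filter_subset _ _)
      fun j hj => (Finset.mem_filter.1 hj).2
  have htrans : ∑ i ∈ S, ∑ j ∈ S with j < i,
      (if Transversal (T i) (T j) then volume ((T i).toSet ∩ (T j).toSet) else 0) ≤
      ∑ j ∈ S, ENNReal.ofReal (448 * δ⁻¹ * (T j).area) := by
    rw [Finset.sum_comm' (s' := fun j => S.filter (j < ·)) (t' := S)
      fun i j => by simp only [Finset.mem_filter]; tauto]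
    refine Finset.sum_le_sum fun j _ => ?_
    rw [← Finset.sum_filter]
    exact hS.sum_volume_inter_transversal_le hσm hσ hT hδ
      ((Finset.filter_subset _ _).trans (Finset.filter_subset _ _))
      fun i hi => (Finset.mem_filter.1 hi).2
  calc ∑ i ∈ S, ∑ j ∈ S with j < i, volume ((T i).toSet ∩ (T j).toSet)
      ≤ ∑ i ∈ S, ENNReal.ofReal (T i).area +
          ∑ j ∈ S, ENNReal.ofReal (448 * δ⁻¹ * (T j).area) := by
        refine (Finset.sum_le_sum fun i hi => Finset.sum_le_sum (hsplit i hi)).trans ?_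
        simp_rw [Finset.sum_add_distrib]
        exact add_le_add hpar htrans
    _ = ENNReal.ofReal ((1 + 448 * δ⁻¹) * ∑ i ∈ S, (T i).area) := by
        rw [← Finset.sum_add_distrib, Finset.mul_sum,
          ENNReal.ofReal_sum_of_nonneg fun i hi => mul_nonneg (by positivity) (hA i hi)]
        refine Finset.sum_congr rfl fun i hi => ?_
        rw [← ENNReal.ofReal_add (hA i hi) (mul_nonneg (by positivity) (hA i hi)), one_add_mul]

theorem sum_sum_volume_inter_le (hS : Selected T S) (hσm : Measurable σ)
    (hσ : ∀ x, LipschitzWith K fun y => σ (x, y)) (hT : ∀ i, IsAdmissible σ K δ (T i))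
    (hδ : 0 < δ) (hδ₁ : δ ≤ 1) :
    ∑ i ∈ S, ∑ j ∈ S, volume ((T i).toSet ∩ (T j).toSet) ≤
      ENNReal.ofReal (900 * δ⁻¹ * ∑ i ∈ S, (T i).area) := by
  have hA : 0 ≤ ∑ i ∈ S, (T i).area := Finset.sum_nonneg fun i _ => (T i).area_pos.le
  have hdiag : ∑ i ∈ S, volume ((T i).toSet ∩ (T i).toSet) =
      ENNReal.ofReal (∑ i ∈ S, (T i).area) := by
    simp only [Set.inter_self, volume_toSet,
      ENNReal.ofReal_sum_of_nonneg fun i _ => (T i).area_pos.le]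
  have hδinv : 1 ≤ δ⁻¹ := (one_le_inv₀ hδ).2 hδ₁
  rw [sum_sum_eq_diag_add_two_nsmul S (fun i j => volume ((T i).toSet ∩ (T j).toSet))
    fun i j => by rw [Set.inter_comm], hdiag, two_nsmul]
  refine (add_le_add_right (add_le_add (hS.sum_sum_volume_inter_lt_le hσm hσ hT hδ)
    (hS.sum_sum_volume_inter_lt_le hσm hσ hT hδ)) _).trans ?_
  rw [← ENNReal.ofReal_add (by positivity) (by positivity),
    ← ENNReal.ofReal_add hA (by positivity)]
  exact ENNReal.ofReal_le_ofReal (by nlinarith)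

end Transversal

end Selected

theorem exists_selection [Finite ι] {σ : ℝ × ℝ → ℝ} {K : ℝ≥0} {δ : ℝ}
    (hanti : Antitone fun i => (T i).ℓ) (hσm : Measurable σ)
    (hσ : ∀ x, LipschitzWith K fun y => σ (x, y)) (hT : ∀ i, IsAdmissible σ K δ (T i))
    (hδ : 0 < δ) (hδ₁ : δ ≤ 1) :
    ∃ S : Finset ι,
      volume (⋃ i, (T i).toSet) ≤ ENNReal.ofReal (8001 * ∑ i ∈ S, (T i).area) ∧
      ∑ i ∈ S, ∑ j ∈ S, volume ((T i).toSet ∩ (T j).toSet) ≤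
        ENNReal.ofReal (900 * δ⁻¹ * ∑ i ∈ S, (T i).area) := by
  obtain ⟨S, hS⟩ := exists_greedy_selection
    fun (i : ι) (F : Finset ι) => ∃ z ∈ (T i).toSet, Free T F z
  have hselected : Selected T S := ⟨hanti.antitoneOn S, fun i hi => (hS i).1 hi⟩
  refine ⟨S, volume_iUnion_le_of_forall_not_free fun i hi z hz hfree => hi ((hS i).2
    ⟨z, hz, hfree.mono (S.filter_subset _)⟩), ?_⟩
  exact hselected.sum_sum_volume_inter_le hσm hσ hT hδ hδ₁

end Selection

end Tube

section Plane

theorem plane_inner (x y : Plane) : inner ℝ x y = x 0 * y 0 + x 1 * y 1 := by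
  rw [PiLp.inner_apply, Fin.sum_univ_two]
  simp only [RCLike.inner_apply, conj_trivial, mul_comm]

@[simp] theorem perp_zero (x : Plane) : perp x 0 = -x 1 := rfl

@[simp] theorem perp_one (x : Plane) : perp x 1 = x 0 := rfl

theorem inner_perp_perp (x y : Plane) : inner ℝ (perp x) (perp y) = inner ℝ x y := by
  simp only [plane_inner, perp_zero, perp_one]
  ring

theorem inner_perp_right (x y : Plane) : inner ℝ x (perp y) = -inner ℝ (perp x) y := by
  simp only [plane_inner, perp_zero, perp_one]
  ring

theorem inner_perp_self (x : Plane) : inner ℝ (perp x) x = 0 := by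
  simp only [plane_inner, perp_zero, perp_one]
  ring

theorem norm_perp (x : Plane) : ‖perp x‖ = ‖x‖ := by
  rw [norm_eq_sqrt_real_inner, norm_eq_sqrt_real_inner, inner_perp_perp]

theorem orthonormal_perp (u : Circ) : Orthonormal ℝ ![(u : Plane), perp u] := by
  rw [orthonormal_iff_ite]
  intro i j
  fin_cases i <;> fin_cases j <;> simp [plane_inner, norm_perp] <;> ring

/-- The orthonormal basis `(u, perp u)`. -/
noncomputable def frame (u : Circ) : OrthonormalBasis (Fin 2) ℝ Plane :=
  OrthonormalBasis.mk (orthonormal_perp u)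
    ((orthonormal_perp u).linearIndependent.span_eq_top_of_card_eq_finrank (by simp)).ge

@[simp] theorem frame_zero (u : Circ) : frame u 0 = u := by simp [frame]

@[simp] theorem frame_one (u : Circ) : frame u 1 = perp u := by simp [frame]

theorem inner_mul_inner_add_inner_perp_mul_inner_perp (u : Circ) (x y : Plane) :
    inner ℝ (u : Plane) x * inner ℝ (u : Plane) y + inner ℝ (perp u) x * inner ℝ (perp u) y =
      inner ℝ x y := by
  simpa only [Fin.sum_univ_two, frame_zero, frame_one, real_inner_comm] using
    (frame u).sum_inner_mul_inner x y

/-- Cartesian coordinates with respect to the frame `(u, perp u)`. -/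
noncomputable def coords (u : Circ) : Plane ≃ᵐ ℝ × ℝ :=
  ((frame u).measurableEquiv.trans (MeasurableEquiv.toLp 2 (Fin 2 → ℝ)).symm).trans
    MeasurableEquiv.finTwoArrow

theorem coords_apply (u : Circ) (z : Plane) :
    coords u z = (inner ℝ (u : Plane) z, inner ℝ (perp u) z) := by
  have hrepr : coords u z = ((frame u).repr z 0, (frame u).repr z 1) := rfl
  rw [hrepr, (frame u).repr_apply_apply, (frame u).repr_apply_apply, frame_zero, frame_one]

theorem measurePreserving_coords (u : Circ) : MeasurePreserving (coords u) volume volume :=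
  ((frame u).measurePreserving_measurableEquiv.trans
    (EuclideanSpace.volume_preserving_symm_measurableEquiv_toLp (Fin 2))).trans
    (volume_preserving_finTwoArrow ℝ)

theorem coords_symm_apply (u : Circ) (c : ℝ × ℝ) :
    (coords u).symm c = c.1 • (u : Plane) + c.2 • perp u := by
  rw [MeasurableEquiv.symm_apply_eq, coords_apply]
  simp [inner_add_right, inner_smul_right, inner_perp_right, inner_perp_self, norm_perp]

theorem dist_coords_symm_mk_left (u : Circ) (x y y' : ℝ) :
    dist ((coords u).symm (x, y)) ((coords u).symm (x, y')) = dist y y' := by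
  rw [coords_symm_apply, coords_symm_apply, dist_add_left, dist_eq_norm, ← sub_smul, norm_smul,
    norm_perp, norm_eq_of_mem_sphere, mul_one, dist_eq_norm]

theorem dist_le_angle (a b : Circ) :
    dist a b ≤ InnerProductGeometry.angle (a : Plane) (b : Plane) := by
  set θ := InnerProductGeometry.angle (a : Plane) (b : Plane)
  have hcos : inner ℝ (a : Plane) (b : Plane) = Real.cos θ := by
    simp [θ, InnerProductGeometry.cos_angle]
  have hsq : ‖(a : Plane) - b‖ ^ 2 = 2 * (1 - Real.cos θ) := by
    rw [norm_sub_sq_real, hcos, norm_eq_of_mem_sphere, norm_eq_of_mem_sphere]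
    ring
  rw [Subtype.dist_eq, dist_eq_norm]
  refine le_of_sq_le_sq ?_ (InnerProductGeometry.angle_nonneg _ _)
  linarith [Real.one_sub_sq_div_two_le_cos (x := θ)]

end Plane

section Slope

theorem abs_div_sub_div_le {r s t M N d : ℝ} (hr : 0 < r) (hM : r ≤ M) (hN : r ≤ N)
    (ht : |t| ≤ 1) (hst : |s - t| ≤ d) (hMN : |M - N| ≤ d) :
    |s / M - t / N| ≤ (r⁻¹ + r⁻¹ ^ 2) * d := by
  have hM₀ : 0 < M := hr.trans_le hM
  have hN₀ : 0 < N := hr.trans_le hN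
  have hd : 0 ≤ d := (abs_nonneg _).trans hst
  have hMinv : M⁻¹ ≤ r⁻¹ := inv_anti₀ hr hM
  have hNinv : N⁻¹ ≤ r⁻¹ := inv_anti₀ hr hN
  calc |s / M - t / N| = |(s - t) * M⁻¹ + t * (N - M) * (M⁻¹ * N⁻¹)| := by
        congr 1
        field_simp
        ring
    _ ≤ |s - t| * M⁻¹ + |t| * |M - N| * (M⁻¹ * N⁻¹) := by
        refine (abs_add_le _ _).trans_eq ?_
        rw [abs_mul, abs_mul, abs_mul, abs_sub_comm N M, abs_of_pos (inv_pos.2 hM₀),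
          abs_of_pos (mul_pos (inv_pos.2 hM₀) (inv_pos.2 hN₀))]
    _ ≤ d * r⁻¹ + 1 * d * (r⁻¹ * r⁻¹) := by gcongr
    _ = (r⁻¹ + r⁻¹ ^ 2) * d := by ring

/-- The slope of a vector in the frame `(u, perp u)`. It is the true slope only of vectors whose
`u`-coordinate is at least `7 / 10`; the cutoff makes it Lipschitz on the whole circle. -/
noncomputable def slope (u : Circ) (a : Plane) : ℝ :=
  inner ℝ (perp u) a / max (inner ℝ (u : Plane) a) (7 / 10)

theorem lipschitzWith_slope (u : Circ) : LipschitzWith (7 / 2) fun a : Circ => slope u a := by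
  refine LipschitzWith.of_dist_le_mul fun a b => ?_
  have hinner : ∀ x : Plane, ‖x‖ = 1 →
      |inner ℝ x (a : Plane) - inner ℝ x (b : Plane)| ≤ dist a b := by
    intro x hx
    rw [← inner_sub_right, Subtype.dist_eq, dist_eq_norm]
    simpa only [hx, one_mul] using abs_real_inner_le_norm x ((a : Plane) - b)
  have hu : ‖(u : Plane)‖ = 1 := norm_eq_of_mem_sphere u
  have hpu : ‖perp (u : Plane)‖ = 1 := (norm_perp _).trans hu
  have ht : |inner ℝ (perp (u : Plane)) (b : Plane)| ≤ 1 := by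
    simpa only [hpu, norm_eq_of_mem_sphere, one_mul] using
      abs_real_inner_le_norm (perp (u : Plane)) (b : Plane)
  calc dist (slope u a) (slope u b) ≤ ((7 / 10 : ℝ)⁻¹ + (7 / 10 : ℝ)⁻¹ ^ 2) * dist a b :=
        abs_div_sub_div_le (by norm_num) (le_max_right _ _) (le_max_right _ _) ht
          (hinner _ hpu) ((abs_max_sub_max_le_abs _ _ _).trans (hinner _ hu))
    _ ≤ 7 / 2 * dist a b := by
        gcongr
        norm_num

/-- The slope of the vector field `v`, as a function of the coordinates in the frame
`(u, perp u)`. -/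
noncomputable def slopeField (u : Circ) (v : Plane → Circ) (z : ℝ × ℝ) : ℝ :=
  slope u (v ((coords u).symm z))

variable {v : Plane → Circ}

theorem measurable_slopeField (hv : Measurable v) (u : Circ) : Measurable (slopeField u v) :=
  (lipschitzWith_slope u).continuous.measurable.comp (hv.comp (coords u).symm.measurable)

theorem lipschitzWith_slopeField {K : ℝ≥0} (hv : LipschitzWith K v) (u : Circ) (x : ℝ) :
    LipschitzWith (7 / 2 * K) fun y => slopeField u v (x, y) := by
  have hx : LipschitzWith 1 fun y => (coords u).symm (x, y) :=
    LipschitzWith.of_dist_le_mul fun y y' => by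
      rw [dist_coords_symm_mk_left, NNReal.coe_one, one_mul]
  exact ((lipschitzWith_slope u).comp (hv.comp hx)).weaken (by rw [mul_one])

end Slope

namespace Rect

variable (R : Rect)

theorem W_pos : 0 < R.W := sub_pos.2 R.width_pos

theorem W_le_L : R.W ≤ R.L := R.width_le_length

theorem L_pos : 0 < R.L := R.W_pos.trans_le R.W_le_L

theorem toSet_eq_preimage :
    R.toSet = coords R.e ⁻¹' (Set.Icc R.a₁ R.a₂ ×ˢ Set.Icc R.b₁ R.b₂) := by
  ext z
  rw [Set.mem_preimage, coords_apply]
  rfl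

theorem volume_toSet : volume R.toSet = ENNReal.ofReal (R.L * R.W) := by
  rw [R.toSet_eq_preimage, (measurePreserving_coords R.e).measure_preimage_equiv,
    Measure.volume_eq_prod, Measure.prod_prod, Real.volume_Icc, Real.volume_Icc,
    ENNReal.ofReal_mul R.L_pos.le]
  rfl

theorem measurableSet_toSet : MeasurableSet R.toSet := by
  rw [R.toSet_eq_preimage]
  exact (coords R.e).measurable (measurableSet_Icc.prod measurableSet_Icc)

theorem convex_toSet : Convex ℝ R.toSet :=
  ((convex_Icc R.a₁ R.a₂).linear_preimage (innerₛₗ ℝ (R.e : Plane))).inter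
    ((convex_Icc R.b₁ R.b₂).linear_preimage (innerₛₗ ℝ (perp (R.e : Plane))))

theorem interior_toSet_nonempty : (interior R.toSet).Nonempty := by
  by_contra! hempty
  have hfrontier : R.toSet ⊆ frontier R.toSet := by
    rw [frontier, hempty, Set.sdiff_empty]
    exact subset_closure
  have hnull := measure_mono_null hfrontier (R.convex_toSet.addHaar_frontier volume)
  rw [R.volume_toSet, ENNReal.ofReal_eq_zero] at hnull
  exact hnull.not_gt (mul_pos R.L_pos R.W_pos)

/-- The center of the rectangle. -/
noncomputable def center : Plane := (coords R.e).symm ((R.a₁ + R.a₂) / 2, (R.b₁ + R.b₂) / 2)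

theorem inner_center : inner ℝ (R.e : Plane) R.center = (R.a₁ + R.a₂) / 2 :=
  congr_arg Prod.fst <| (coords_apply _ _).symm.trans <| (coords R.e).apply_symm_apply _

theorem inner_perp_center : inner ℝ (perp (R.e : Plane)) R.center = (R.b₁ + R.b₂) / 2 :=
  congr_arg Prod.snd <| (coords_apply _ _).symm.trans <| (coords R.e).apply_symm_apply _

variable {R}

theorem abs_inner_sub_center_le {z : Plane} (hz : z ∈ R.toSet) :
    |inner ℝ (R.e : Plane) (z - R.center)| ≤ R.L / 2 := by
  rw [inner_sub_right, inner_center]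
  exact (Real.Icc_eq_closedBall _ _).subset hz.1

theorem abs_inner_perp_sub_center_le {z : Plane} (hz : z ∈ R.toSet) :
    |inner ℝ (perp (R.e : Plane)) (z - R.center)| ≤ R.W / 2 := by
  rw [inner_sub_right, inner_perp_center]
  exact (Real.Icc_eq_closedBall _ _).subset hz.2

variable (R) in
/-- A tube containing the rectangle `R`, in the coordinates of the frame `(u, perp u)`. -/
noncomputable def tube (u : Circ) : Tube where
  p := inner ℝ (u : Plane) R.center
  q := inner ℝ (perp u) R.center
  ℓ := R.L
  w := 2 * R.W
  m := slope u R.e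
  ℓ_pos := R.L_pos
  w_pos := mul_pos two_pos R.W_pos

theorem area_tube (u : Circ) : (R.tube u).area = 8 * (R.L * R.W) := by
  simp only [Tube.area, tube]
  ring

theorem abs_inner_sub_center_le_L (u : Circ) {z : Plane} (hz : z ∈ R.toSet) :
    |inner ℝ (u : Plane) (z - R.center)| ≤ R.L := by
  set x := z - R.center
  have hL : inner ℝ (R.e : Plane) x ^ 2 ≤ (R.L / 2) ^ 2 :=
    sq_le_sq' (abs_le.1 (abs_inner_sub_center_le hz)).1 (abs_le.1 (abs_inner_sub_center_le hz)).2
  have hW : inner ℝ (perp (R.e : Plane)) x ^ 2 ≤ (R.W / 2) ^ 2 :=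
    sq_le_sq' (abs_le.1 (abs_inner_perp_sub_center_le hz)).1
      (abs_le.1 (abs_inner_perp_sub_center_le hz)).2
  have hnorm := inner_mul_inner_add_inner_perp_mul_inner_perp R.e x x
  rw [real_inner_self_eq_norm_sq] at hnorm
  have hx : ‖x‖ ≤ R.L := le_of_sq_le_sq (by nlinarith [R.W_pos, R.W_le_L]) R.L_pos.le
  calc |inner ℝ (u : Plane) x| ≤ ‖(u : Plane)‖ * ‖x‖ := abs_real_inner_le_norm _ _
    _ ≤ R.L := by rwa [norm_eq_of_mem_sphere, one_mul]

theorem abs_inner_perp_sub_slope_mul_le {u : Circ}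
    (hu : 7 / 10 ≤ inner ℝ (u : Plane) (R.e : Plane)) {z : Plane} (hz : z ∈ R.toSet) :
    |inner ℝ (perp u) (z - R.center) - slope u R.e * inner ℝ (u : Plane) (z - R.center)| ≤
      2 * R.W := by
  have hc : 0 < inner ℝ (u : Plane) (R.e : Plane) := by linarith
  have hrot := inner_mul_inner_add_inner_perp_mul_inner_perp u (perp R.e) (z - R.center)
  rw [inner_perp_perp, inner_perp_right] at hrot
  rw [slope, max_eq_left hu, div_mul_eq_mul_div, sub_div' hc.ne', abs_div, abs_of_pos hc,
    div_le_iff₀ hc]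
  calc |inner ℝ (perp u) (z - R.center) * inner ℝ (u : Plane) (R.e : Plane) -
        inner ℝ (perp u) (R.e : Plane) * inner ℝ (u : Plane) (z - R.center)|
      = |inner ℝ (perp (R.e : Plane)) (z - R.center)| := by
        rw [← hrot]
        congr 1
        ring
    _ ≤ R.W / 2 := abs_inner_perp_sub_center_le hz
    _ ≤ 2 * R.W * inner ℝ (u : Plane) (R.e : Plane) := by nlinarith [R.W_pos]

theorem coords_mem_tube {u : Circ} (hu : 7 / 10 ≤ inner ℝ (u : Plane) (R.e : Plane)) {z : Plane}
    (hz : z ∈ R.toSet) : coords u z ∈ (R.tube u).toSet := by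
  rw [coords_apply, Tube.mem_toSet, Tube.line, tube, ← sub_sub]
  simp only [← inner_sub_right]
  exact ⟨abs_inner_sub_center_le_L u hz, abs_inner_perp_sub_slope_mul_le hu hz⟩

theorem preimage_coords_symm_subset_tube {u : Circ}
    (hu : 7 / 10 ≤ inner ℝ (u : Plane) (R.e : Plane)) :
    (coords u).symm ⁻¹' R.toSet ⊆ (R.tube u).toSet := fun c hc => by
  simpa only [MeasurableEquiv.apply_symm_apply] using coords_mem_tube hu hc

theorem preimage_coords_symm_V_subset {u : Circ}
    (hu : 7 / 10 ≤ inner ℝ (u : Plane) (R.e : Plane)) (v : Plane → Circ) :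
    (coords u).symm ⁻¹' R.V v ⊆ Tube.V (slopeField u v) (R.tube u) := by
  refine fun c hc => ⟨preimage_coords_symm_subset_tube hu hc.1, ?_⟩
  have hWL : 0 < R.W / R.L := div_pos R.W_pos R.L_pos
  set a := v ((coords u).symm c)
  calc |slope u a - slope u R.e| ≤ 7 / 2 * dist a R.e := (lipschitzWith_slope u).dist_le_mul a R.e
    _ ≤ 7 / 2 * (R.W / R.L / 2) := by
        gcongr
        rw [dist_comm]
        exact (dist_le_angle R.e a).trans hc.2
    _ ≤ 2 * R.W / R.L := by
        rw [mul_div_assoc]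
        linarith

end Rect

theorem isClosed_setOf_lipschitzWith {α β : Type*} [PseudoMetricSpace α] [PseudoMetricSpace β]
    (f : α → β) : IsClosed {K : ℝ≥0 | LipschitzWith K f} := by
  simp only [lipschitzWith_iff_dist_le_mul, Set.ofPred_forall]
  exact isClosed_iInter fun x => isClosed_iInter fun y => isClosed_le (by fun_prop) (by fun_prop)

theorem lipschitzWith_lipNorm {v : Plane → Circ} (hv : ∃ K : ℝ≥0, LipschitzWith K v) :
    LipschitzWith (lipNorm v) v :=
  (isClosed_setOf_lipschitzWith v).csInf_mem hv (OrderBot.bddBelow _)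

namespace Admissible

variable {v : Plane → Circ} {δ : ℝ} {R : Rect}

theorem lipNorm_mul_L_le (h : Admissible v δ R) : lipNorm v * R.L ≤ 1 / 100 := by
  have hle : 100 * (lipNorm v : ℝ≥0∞) * ENNReal.ofReal R.L ≤ 1 :=
    ENNReal.mul_le_of_le_div' (by simpa only [one_div] using h.1)
  rw [← ENNReal.ofReal_coe_nnreal, ← ENNReal.ofReal_ofNat 100, ← ENNReal.ofReal_mul (by norm_num),
    ← ENNReal.ofReal_mul (by positivity), ENNReal.ofReal_le_one] at hle
  linarith

theorem isAdmissible_tube (h : Admissible v δ R) {u : Circ}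
    (hu : 7 / 10 ≤ inner ℝ (u : Plane) (R.e : Plane)) :
    Tube.IsAdmissible (slopeField u v) (7 / 2 * lipNorm v) (δ / 8) (R.tube u) where
  lipschitz_mul_length_le := by
    change 7 / 2 * (lipNorm v : ℝ) * R.L ≤ 1 / 25
    linarith [h.lipNorm_mul_L_le]
  density_le := calc
    ENNReal.ofReal (δ / 8 * (R.tube u).area) = ENNReal.ofReal δ * volume R.toSet := by
        rw [Rect.area_tube, Rect.volume_toSet, ← ENNReal.ofReal_mul' (mul_pos R.L_pos R.W_pos).le]
        congr 1
        ring
    _ ≤ volume (R.V v) := h.2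
    _ = volume ((coords u).symm ⁻¹' R.V v) :=
        ((measurePreserving_coords u).symm.measure_preimage_equiv _).symm
    _ ≤ volume (Tube.V (slopeField u v) (R.tube u)) :=
        measure_mono (R.preimage_coords_symm_V_subset hu v)

end Admissible

variable {v : Plane → Circ} {δ : ℝ}

theorem exists_rect_selection {ι : Type*} [LinearOrder ι] [Finite ι] {R : ι → Rect}
    (hanti : Antitone fun i => (R i).L) (hv : LipschitzWith (lipNorm v) v) (hδ : 0 < δ)
    (hδ₁ : δ ≤ 1) (hR : ∀ i, Admissible v δ (R i)) {u : Circ}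
    (hu : ∀ i, 7 / 10 ≤ inner ℝ (u : Plane) ((R i).e : Plane)) :
    ∃ S : Finset ι,
      volume (⋃ i, (R i).toSet) ≤ ENNReal.ofReal 64008 * ∑ i ∈ S, volume (R i).toSet ∧
      ∑ i ∈ S, ∑ j ∈ S, volume ((R i).toSet ∩ (R j).toSet) ≤
        ENNReal.ofReal (57600 * δ⁻¹) * ∑ i ∈ S, volume (R i).toSet := by
  obtain ⟨S, hcover, hoverlap⟩ := Tube.exists_selection (T := fun i => (R i).tube u) hanti
    (measurable_slopeField hv.continuous.measurable u) (lipschitzWith_slopeField hv u)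
    (fun i => (hR i).isAdmissible_tube (hu i)) (by positivity) (by linarith)
  have hpre : ∀ A : Set Plane, volume ((coords u).symm ⁻¹' A) = volume A := fun A =>
    (measurePreserving_coords u).symm.measure_preimage_equiv A
  have hsub : ∀ i, (coords u).symm ⁻¹' (R i).toSet ⊆ ((R i).tube u).toSet := fun i =>
    Rect.preimage_coords_symm_subset_tube (hu i)
  have harea : ∀ c : ℝ, 0 ≤ c → ENNReal.ofReal (c * ∑ i ∈ S, ((R i).tube u).area) =
      ENNReal.ofReal (c * 8) * ∑ i ∈ S, volume (R i).toSet := by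
    intro c hc
    simp only [Rect.area_tube, Rect.volume_toSet, ← Finset.mul_sum]
    rw [← mul_assoc, ENNReal.ofReal_mul (by positivity),
      ENNReal.ofReal_sum_of_nonneg fun i _ => (mul_pos (R i).L_pos (R i).W_pos).le]
  refine ⟨S, ?_, ?_⟩
  · calc volume (⋃ i, (R i).toSet) = volume (⋃ i, (coords u).symm ⁻¹' (R i).toSet) := by
          rw [← Set.preimage_iUnion, hpre]
      _ ≤ _ := (measure_mono (Set.iUnion_mono hsub)).trans hcover
      _ = _ := by
          rw [harea _ (by norm_num)]
          norm_num
  · calc ∑ i ∈ S, ∑ j ∈ S, volume ((R i).toSet ∩ (R j).toSet)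
        = ∑ i ∈ S, ∑ j ∈ S,
            volume ((coords u).symm ⁻¹' (R i).toSet ∩ (coords u).symm ⁻¹' (R j).toSet) := by
          simp only [← Set.preimage_inter, hpre]
      _ ≤ _ := (Finset.sum_le_sum fun i _ => Finset.sum_le_sum fun j _ =>
          measure_mono (Set.inter_subset_inter (hsub i) (hsub j))).trans hoverlap
      _ = _ := by
          rw [harea _ (by positivity), inv_div]
          ring_nf

/-- The admissible rectangles over which `f` has mean larger than `c`; their union is a
superlevel set of the maximal function. -/
def largeMeanRects (v : Plane → Circ) (δ : ℝ) (f : Plane → ℂ) (c : ℝ≥0∞) : Set Rect :=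
  {R | Admissible v δ R ∧ c < (volume R.toSet)⁻¹ * ∫⁻ y in R.toSet, ‖f y‖ₑ}

theorem mul_volume_le_of_mem_largeMeanRects {f : Plane → ℂ} {c : ℝ≥0∞} {R : Rect}
    (hR : R ∈ largeMeanRects v δ f c) :
    c * volume R.toSet ≤ ∫⁻ y in R.toSet, ‖f y‖ₑ := by
  refine ENNReal.mul_le_of_le_div ?_
  rw [div_eq_mul_inv, mul_comm]
  exact hR.2.le

theorem setOf_lt_maximalFn (v : Plane → Circ) (δ : ℝ) (f : Plane → ℂ) (c : ℝ≥0∞) :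
    {x | c < maximalFn v δ f x} = ⋃ R : largeMeanRects v δ f c, (R : Rect).toSet := by
  ext x
  simp only [maximalFn, Set.mem_ofPred_eq, lt_iSup_iff, Set.mem_iUnion]
  constructor
  · rintro ⟨R, hR, hlt⟩
    have hx : x ∈ R.toSet := Set.mem_of_indicator_ne_zero hlt.ne_bot
    rw [Set.indicator_of_mem hx] at hlt
    exact ⟨⟨R, hR, hlt⟩, hx⟩
  · rintro ⟨⟨R, hR, hlt⟩, hx⟩
    refine ⟨R, hR, ?_⟩
    rwa [Set.indicator_of_mem hx]

section WeakType

variable {f : Plane → ℂ} {t : ℝ}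

theorem volume_biUnion_le_of_inner_ge (hv : LipschitzWith (lipNorm v) v) (hδ : 0 < δ)
    (hδ₁ : δ ≤ 1) (hf : AEStronglyMeasurable f volume) (ht : 0 < t)
    (F : Finset (largeMeanRects v δ f (ENNReal.ofReal t))) {u : Circ}
    (hu : ∀ R ∈ F, 7 / 10 ≤ inner ℝ (u : Plane) ((R : Rect).e : Plane)) :
    volume (⋃ R ∈ F, (R : Rect).toSet) ≤
      ENNReal.ofReal (4 * 10 ^ 9 * δ⁻¹ * (t ^ 2)⁻¹) * eLpNorm f 2 volume ^ 2 := by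
  obtain ⟨R, hanti, hrange⟩ := exists_antitone_enumeration F fun R => (R : Rect).L
  have hRF : ∀ i, R i ∈ F := fun i => Finset.mem_coe.1 (hrange ▸ Set.mem_range_self i)
  have hunion : ⋃ Q ∈ F, (Q : Rect).toSet = ⋃ i, (R i : Rect).toSet := by
    simp only [← Finset.mem_coe, ← hrange, Set.biUnion_range]
  obtain ⟨S, hcover, hoverlap⟩ := exists_rect_selection (R := fun i => (R i : Rect)) hanti hv hδ hδ₁
    (fun i => (R i).2.1) fun i => hu _ (hRF i)
  have hduality := sq_mul_sum_measure_le volume (fun i _ => (R i : Rect).measurableSet_toSet)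
    (fun i _ => (R i : Rect).volume_toSet.trans_ne ENNReal.ofReal_ne_top) hf.enorm
    (fun i _ => mul_volume_le_of_mem_largeMeanRects (R i).2) hoverlap
  have hnorm : ∫⁻ x, ‖f x‖ₑ ^ 2 = eLpNorm f 2 volume ^ 2 := by
    simpa using (eLpNorm_nnreal_pow_eq_lintegral (f := f) (μ := volume) (p := 2) two_ne_zero).symm
  have hsum : ∑ i ∈ S, volume (R i : Rect).toSet ≤
      ENNReal.ofReal (57600 * δ⁻¹ * (t ^ 2)⁻¹) * eLpNorm f 2 volume ^ 2 := by
    have ht₂ : 0 < t ^ 2 := by positivity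
    rw [← ENNReal.ofReal_pow ht.le, hnorm, mul_comm,
      ← ENNReal.le_div_iff_mul_le (.inl (ENNReal.ofReal_pos.2 ht₂).ne')
        (.inl ENNReal.ofReal_ne_top), div_eq_mul_inv, mul_right_comm,
      ← ENNReal.ofReal_inv_of_pos ht₂, ← ENNReal.ofReal_mul (by positivity)] at hduality
    exact hduality
  calc volume (⋃ Q ∈ F, (Q : Rect).toSet)
      ≤ ENNReal.ofReal 64008 * ∑ i ∈ S, volume (R i : Rect).toSet := by rwa [hunion]
    _ ≤ ENNReal.ofReal 64008 *
          (ENNReal.ofReal (57600 * δ⁻¹ * (t ^ 2)⁻¹) * eLpNorm f 2 volume ^ 2) := by gcongr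
    _ ≤ ENNReal.ofReal (4 * 10 ^ 9 * δ⁻¹ * (t ^ 2)⁻¹) * eLpNorm f 2 volume ^ 2 := by
        rw [← mul_assoc, ← ENNReal.ofReal_mul (by norm_num)]
        have : 0 ≤ δ⁻¹ * (t ^ 2)⁻¹ := by positivity
        gcongr ENNReal.ofReal ?_ * _
        linarith

theorem exists_four_directions :
    ∃ u : Fin 4 → Circ, ∀ e : Circ, ∃ k, 7 / 10 ≤ inner ℝ (u k : Plane) (e : Plane) := by
  have hmem : ∀ a b : ℝ, a ^ 2 + b ^ 2 = 1 → (!₂[a, b] : Plane) ∈ Metric.sphere (0 : Plane) 1 := by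
    intro a b hab
    rw [mem_sphere_zero_iff_norm, EuclideanSpace.norm_eq, Fin.sum_univ_two]
    simp [hab]
  refine ⟨![⟨!₂[1, 0], hmem _ _ (by norm_num)⟩, ⟨!₂[0, 1], hmem _ _ (by norm_num)⟩,
    ⟨!₂[-1, 0], hmem _ _ (by norm_num)⟩, ⟨!₂[0, -1], hmem _ _ (by norm_num)⟩], fun e => ?_⟩
  by_contra! hlt
  obtain ⟨h₀, h₁, h₂, h₃⟩ :
      e.1 0 < 7 / 10 ∧ e.1 1 < 7 / 10 ∧ -e.1 0 < 7 / 10 ∧ -e.1 1 < 7 / 10 := by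
    simpa [plane_inner, Fin.forall_fin_succ] using hlt
  have hnorm := real_inner_self_eq_norm_sq (e : Plane)
  rw [norm_eq_of_mem_sphere, plane_inner] at hnorm
  nlinarith

theorem volume_biUnion_le (hv : LipschitzWith (lipNorm v) v) (hδ : 0 < δ) (hδ₁ : δ ≤ 1)
    (hf : AEStronglyMeasurable f volume) (ht : 0 < t)
    (F : Finset (largeMeanRects v δ f (ENNReal.ofReal t))) :
    volume (⋃ R ∈ F, (R : Rect).toSet) ≤
      ENNReal.ofReal (16 * 10 ^ 9 * δ⁻¹ * (t ^ 2)⁻¹) * eLpNorm f 2 volume ^ 2 := by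
  classical
  obtain ⟨u, hu⟩ := exists_four_directions
  let G (k : Fin 4) : Finset (largeMeanRects v δ f (ENNReal.ofReal t)) :=
    F.filter fun R => 7 / 10 ≤ inner ℝ (u k : Plane) ((R : Rect).e : Plane)
  have hcover : ⋃ R ∈ F, (R : Rect).toSet ⊆ ⋃ k, ⋃ R ∈ G k, (R : Rect).toSet := by
    intro x hx
    simp only [Set.mem_iUnion] at hx ⊢
    obtain ⟨R, hR, hxR⟩ := hx
    obtain ⟨k, hk⟩ := hu (R : Rect).e
    exact ⟨k, R, Finset.mem_filter.2 ⟨hR, hk⟩, hxR⟩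
  calc volume (⋃ R ∈ F, (R : Rect).toSet)
      ≤ ∑ k, volume (⋃ R ∈ G k, (R : Rect).toSet) :=
        (measure_mono hcover).trans (measure_iUnion_fintype_le _ _)
    _ ≤ ∑ _k : Fin 4, ENNReal.ofReal (4 * 10 ^ 9 * δ⁻¹ * (t ^ 2)⁻¹) * eLpNorm f 2 volume ^ 2 :=
        Finset.sum_le_sum fun k _ => volume_biUnion_le_of_inner_ge hv hδ hδ₁ hf ht (G k)
          fun R hR => (Finset.mem_filter.1 hR).2
    _ = ENNReal.ofReal (16 * 10 ^ 9 * δ⁻¹ * (t ^ 2)⁻¹) * eLpNorm f 2 volume ^ 2 := by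
        rw [Finset.sum_const, Finset.card_univ, Fintype.card_fin, nsmul_eq_mul, ← mul_assoc,
          Nat.cast_ofNat, ← ENNReal.ofReal_ofNat 4, ← ENNReal.ofReal_mul (by norm_num)]
        ring_nf

end WeakType

section Interiors

variable {ι : Type*} (R : ι → Rect)

theorem Rect.iUnion_interior_ae_eq_iUnion :
    ⋃ i, interior (R i).toSet =ᵐ[volume] ⋃ i, (R i).toSet :=
  ae_eq_set.2 ⟨by simp [Set.sdiff_eq_empty.2 (Set.iUnion_mono fun _ => interior_subset)],
    addHaar_iUnion_diff_iUnion_interior volume (fun i => (R i).convex_toSet)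
      fun i => (R i).interior_toSet_nonempty⟩

theorem Rect.nullMeasurableSet_iUnion_toSet : NullMeasurableSet (⋃ i, (R i).toSet) :=
  (isOpen_iUnion fun _ => isOpen_interior).measurableSet.nullMeasurableSet.congr
    (Rect.iUnion_interior_ae_eq_iUnion R)

theorem Rect.volume_iUnion_toSet_le_of_forall_finset {B : ℝ≥0∞}
    (hB : ∀ F : Finset ι, volume (⋃ i ∈ F, (R i).toSet) ≤ B) :
    volume (⋃ i, (R i).toSet) ≤ B := by
  have hopen : IsOpen (⋃ i, interior (R i).toSet) := isOpen_iUnion fun _ => isOpen_interior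
  rw [← measure_congr (Rect.iUnion_interior_ae_eq_iUnion R), hopen.measure_eq_iSup_isCompact]
  refine iSup₂_le fun K hKsub => iSup_le fun hK => ?_
  obtain ⟨F, hF⟩ := hK.elim_finite_subcover _ (fun _ => isOpen_interior) hKsub
  exact (measure_mono (hF.trans (Set.iUnion₂_mono fun _ _ => interior_subset))).trans (hB F)

end Interiors

theorem aemeasurable_maximalFn (v : Plane → Circ) (δ : ℝ) (f : Plane → ℂ) :
    AEMeasurable (maximalFn v δ f) volume := by
  refine NullMeasurable.aemeasurable (μ := volume) ?_
  refine measurable_of_Ioi (α := ℝ≥0∞) (δ := NullMeasurableSpace Plane volume) fun c => ?_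
  change NullMeasurableSet {x | c < maximalFn v δ f x} volume
  rw [setOf_lt_maximalFn]
  exact Rect.nullMeasurableSet_iUnion_toSet _

theorem volume_setOf_lt_maximalFn_le (hv : LipschitzWith (lipNorm v) v) (hδ : 0 < δ) (hδ₁ : δ ≤ 1)
    {f : Plane → ℂ} (hf : AEStronglyMeasurable f volume) {t : ℝ} (ht : 0 < t) :
    volume {x | ENNReal.ofReal t < maximalFn v δ f x} ≤
      ENNReal.ofReal (16 * 10 ^ 9 * δ⁻¹ * (t ^ 2)⁻¹) * eLpNorm f 2 volume ^ 2 := by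
  rw [setOf_lt_maximalFn]
  exact Rect.volume_iUnion_toSet_le_of_forall_finset _ (volume_biUnion_le hv hδ hδ₁ hf ht)

end LipKakeya

theorem theorem1p4 :
    ∃ C : ℝ, 0 < C ∧
      ∀ v : LipKakeya.Plane → LipKakeya.Circ, (∃ K : ℝ≥0, LipschitzWith K v) →
      ∀ δ : ℝ, 0 < δ → δ < 1 →
      ∀ f : LipKakeya.Plane → ℂ, MemLp f 2 volume →
        AEMeasurable (LipKakeya.maximalFn v δ f) volume ∧
        ∀ t : ℝ, 0 < t →
          volume {x : LipKakeya.Plane | ENNReal.ofReal t < LipKakeya.maximalFn v δ f x} ≤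
            ENNReal.ofReal (C * δ⁻¹ * (t ^ 2)⁻¹) * eLpNorm f 2 volume ^ 2 := by
  refine ⟨16 * 10 ^ 9, by norm_num, fun v hv δ hδ hδ₁ f hf =>
    ⟨LipKakeya.aemeasurable_maximalFn v δ f, fun t ht => ?_⟩⟩
  exact LipKakeya.volume_setOf_lt_maximalFn_le (LipKakeya.lipschitzWith_lipNorm hv) hδ hδ₁.le
    hf.aestronglyMeasurable ht
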